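/- Let $m\ge 2$, let $\Omega\subset\mathbb R^m$ be open, and let $\alpha>0$. For $u\in L^1(\Omega)$ put $$\mathrm{TV}(u)=\sup\Big\{\int_\Omega u\,\operatorname{div}\varphi\,dx \;\Big|\; \varphi\in C_c^\infty(\Omega;\mathbb R^m),\ \|\varphi(x)\|_2\le 1 \text{ for all } x\Big\}\in[0,\infty];$$ this is the total mass $\|Du\|_{\mathcal M(\Omega;\mathbb R^m)}$ of the distributional gradient $Du$ (it is $\infty$ if $Du$ is not a finite measure). We write $u\in \mathrm{BV}(\Omega)$ if $u\in L^1(\Omega)$ and $Du$ is a finite $\mathbb R^m$-valued Borel measure on $\Omega$; $|Du|$ denotes its total variation measure, and $|Du|(A):=|Du|(A\cap\Omega)$ for Borel sets $A\subset\mathbb R^m$. Weak* convergence $u^i\to u$ in $\mathrm{BV}(\Omega)$ means $u^i\to u$ in $L^1(\Omega)$ and $Du^i\to Du$ weakly* as measures. Let $R:L^1(\Omega)\to[0,\infty]$. * $R$ is *admissible* if it is convex, lower semicontinuous with respect to weak* convergence of sequences in $\mathrm{BV}(\Omega)$, and there is $C>0$ with $\|Du\|_{\mathcal M(\Omega;\mathbb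 R^m)}\le C\,(1+\|u\|_{L^1(\Omega)}+R(u))$ for all $u\in L^1(\Omega)$. * For an open set $U\subset\Omega$ let $\mathcal F(\Omega,U)$ be the set of bijections $\gamma:\Omega\to\Omega$ such that $\gamma$ and $\gamma^{-1}$ are Lipschitz and map Lebesgue null sets to Lebesgue null sets, and $\gamma(x)=x$ for $x\in\Omega\setminus U$. Put $\gamma_\#u:=u\circ\gamma^{-1}$. With $\nabla\gamma^{-1}$ the transpose of the derivative of $\gamma^{-1}$, $\mathcal J\gamma=|\det\nabla\gamma|$ and $L_\gamma(x):=\nabla\gamma^{-1}(\gamma(x))\,\mathcal J\gamma(x)$ (all defined for almost every $x\in\Omega$), let $$T(\gamma_1,\gamma_2):=\operatorname*{ess\,sup}_{x\in\Omega}\,\sup_{\|v\|=1}\big(\|L_{\gamma_1}(x)v\|+\|L_{\gamma_2}(x)v\|-2\|v\|\big)+\operatorname*{ess\,sup}_{x\in\Omega}\big|\mathcal J\gamma_1(x)+\mathcal J\gamma_2(x)-2\big|+\sum_{i=1}^2\Big(\operatorname*{ess\,sup}_{x\in\Omega}\big\|\nabla\gamma_i^{-1}(\gamma_i(x))-I\big\|\Big)^2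 .$$ * $R$ is *double-Lipschitz comparable* if there is a constant $R^a\ge0$ such that for all $u\in\mathrm{BV}(\Omega)$, all open $U\subset\Omega$ and all $\gamma_1,\gamma_2\in\mathcal F(\Omega,U)$ with $T(\gamma_1,\gamma_2)<1$, $$R(\gamma_{1\#}u)+R(\gamma_{2\#}u)-2R(u)\le R^a\,T(\gamma_1,\gamma_2)\,|Du|(\overline U).$$ * $R$ is *separably double-Lipschitz comparable* if there are constants $R^a,R^s\ge0$ such that for all such $u$, $U$, $\gamma_1,\gamma_2$ and every Lipschitz $(m-1)$-graph $\Gamma=\{v+f(v)z\mid v\in V\}$ ($z$ a unit vector, $V\subset z^\perp$ relatively open, $f:V\to\mathbb R$ Lipschitz), the functions $\gamma_{1\#}u,\gamma_{2\#}u$ are in $\mathrm{BV}(\Omega)$ and $$R(\gamma_{1\#}u)+R(\gamma_{2\#}u)-2R(u)\le R^a\,T(\gamma_1,\gamma_2)\,|Du|(\overline U\setminus\Gamma)+R^s\big(|D\gamma_{1\#}u|(\gamma_1(\Gamma\cap\Omega))+|D\gamma_{2\#}u|(\gamma_2(\Gamma\cap\Omega))-2|Du|(\Gamma)\big).$$ **Proposition.**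 The functional $R(u)=\alpha\,\mathrm{TV}(u)$ is admissible, double-Lipschitz comparable and separably double-Lipschitz comparable. Moreover, let $\phi:\mathbb R\to[0,\infty]$ be convex and lower semicontinuous with $\phi(0)=0$, and suppose that for some $p\ge1$ and $C_\phi>0$ one has $\phi(x)-\phi(y)\le C_\phi(|x|-|y|)|x|^{p-1}$ for all $x,y\in\mathbb R$. If $f\in L^1(\Omega)$ and $u\in L^1(\Omega)$ is a minimiser of $$v\mapsto\int_\Omega\phi(f(x)-v(x))\,dx+\alpha\,\mathrm{TV}(v)\qquad\text{over } v\in L^1(\Omega),$$ then $\|u\|_{L^\infty(\Omega)}\le\|f\|_{L^\infty(\Omega)}$. -/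

import Mathlib

open Set Filter Topology MeasureTheory
open scoped NNReal ENNReal ContDiff ZeroAtInfty Gradient

noncomputable section

namespace TVReg

/-- `ℝ^m` with the Euclidean norm. -/
abbrev Eu (m : ℕ) : Type := EuclideanSpace ℝ (Fin m)

variable {m : ℕ}

/-! ### Functions of bounded variation

An element of `L¹(Ω)` is represented by a function `u : ℝ^m → ℝ` that is integrable on `Ω`; only its
values on `Ω`, up to null sets, matter. -/

/-- The divergence `∑ i, ∂_i φ_i` of a vector field. -/
def divergence (φ : Eu m → Eu m) (x : Eu m) : ℝ :=
  ∑ i, (fderiv ℝ φ x (EuclideanSpace.single i 1)) i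

/-- The vector fields `φ ∈ C_c^∞(Ω; ℝ^m)` with `‖φ(x)‖₂ ≤ 1` for all `x`. -/
structure IsTestField (Ω : Set (Eu m)) (φ : Eu m → Eu m) : Prop where
  contDiff : ContDiff ℝ ∞ φ
  hasCompactSupport : HasCompactSupport φ
  tsupport_subset : tsupport φ ⊆ Ω
  norm_le_one : ∀ x, ‖φ x‖ ≤ 1

/-- The isotropic total variation
`TV(u) = sup {∫_Ω u div φ | φ ∈ C_c^∞(Ω; ℝ^m), ‖φ‖_∞ ≤ 1} ∈ [0, ∞]`.
It is the total mass `‖Du‖` of the distributional gradient, and it is `∞` if the gradient of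
`u ∈ L¹(Ω)` is not a finite measure. -/
def TV (Ω : Set (Eu m)) (u : Eu m → ℝ) : ℝ≥0∞ :=
  ⨆ (φ : Eu m → Eu m) (_ : IsTestField Ω φ),
    ENNReal.ofReal (∫ x in Ω, u x * divergence φ x)

/-- The finite `ℝ^m`-valued Borel measure `μ` on `Ω` is the distributional gradient `Du`, that is,
`∫_Ω u ∇ψ dx = - ∫_Ω ψ dμ` for all `ψ ∈ C_c^∞(Ω)`.  The total variation measure `|Du|`
is then `μ.variation`. -/
def HasGradientMeasure (Ω : Set (Eu m)) (u : Eu m → ℝ) (μ : VectorMeasure Ω (Eu m)) : Prop :=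
  ∀ ψ : Eu m → ℝ, ContDiff ℝ ∞ ψ → HasCompactSupport ψ → tsupport ψ ⊆ Ω →
    ∫ x in Ω, u x • ∇ ψ x = - ∫ᵛ x : Ω, ψ x ∂•μ

/-- `u ∈ BV(Ω)`. -/
def MemBV (Ω : Set (Eu m)) (u : Eu m → ℝ) : Prop :=
  IntegrableOn u Ω ∧ ∃ μ : VectorMeasure Ω (Eu m), HasGradientMeasure Ω u μ

/-- Weak* convergence in `BV(Ω)`: all functions are in `BV(Ω)`, `u k → u` strongly in `L¹(Ω)`, and
`D(u k) → Du` weakly* in the dual of `C₀(Ω)`. -/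
def WeakStarTendsto (Ω : Set (Eu m)) (u : ℕ → Eu m → ℝ) (v : Eu m → ℝ) : Prop :=
  (∀ k, IntegrableOn (u k) Ω) ∧ IntegrableOn v Ω ∧
  Tendsto (fun k => ∫ x in Ω, |u k x - v x|) atTop (𝓝 0) ∧
  ∃ (μ : ℕ → VectorMeasure Ω (Eu m)) (ν : VectorMeasure Ω (Eu m)),
    (∀ k, HasGradientMeasure Ω (u k) (μ k)) ∧ HasGradientMeasure Ω v ν ∧
    ∀ g : C₀(Ω, ℝ), Tendsto (fun k => ∫ᵛ x : Ω, g x ∂•(μ k)) atTop (𝓝 (∫ᵛ x : Ω, g x ∂•ν))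

/-! ### Admissible regularisation functionals -/

/-- `R` is an admissible regularisation functional on `L¹(Ω)`: it is well defined on `L¹(Ω)`, convex,
(sequentially) lower semicontinuous with respect to weak* convergence in `BV(Ω)`, and
`‖Du‖ ≤ C (1 + ‖u‖₁ + R(u))` on `L¹(Ω)`. -/
structure IsAdmissible (Ω : Set (Eu m)) (R : (Eu m → ℝ) → ℝ≥0∞) : Prop where
  congr_ae : ∀ u v, IntegrableOn u Ω → IntegrableOn v Ω → u =ᵐ[volume.restrict Ω] v → R u = R v
  convex : ∀ u v, IntegrableOn u Ω → IntegrableOn v Ω → ∀ a b : ℝ≥0, a + b = 1 →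
    R (fun x => a * u x + b * v x) ≤ a * R u + b * R v
  lsc : ∀ (u : ℕ → Eu m → ℝ) (v : Eu m → ℝ), WeakStarTendsto Ω u v →
    R v ≤ liminf (fun k => R (u k)) atTop
  coercive : ∃ C : ℝ≥0, 0 < C ∧ ∀ u, IntegrableOn u Ω →
    TV Ω u ≤ C * (1 + (∫⁻ x in Ω, ‖u x‖ₑ) + R u)

/-! ### Lipschitz transformations and double-Lipschitz comparability -/

/-- The class `F(Ω, U)` of bi-Lipschitz bijections `γ : Ω → Ω`, both directions having
the Lusin `N`-property, with `γ(x) = x` for `x ∈ Ω \ U`.  Here `γ.symm` is `γ⁻¹`; the values of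
either map outside `Ω` play no role. -/
structure IsLipTransform (Ω U : Set (Eu m)) (γ : PartialEquiv (Eu m) (Eu m)) : Prop where
  source_eq : γ.source = Ω
  target_eq : γ.target = Ω
  lipschitz : ∃ K : ℝ≥0, LipschitzOnWith K γ Ω
  lipschitz_symm : ∃ K : ℝ≥0, LipschitzOnWith K γ.symm Ω
  lusin : ∀ N ⊆ Ω, volume N = 0 → volume (γ '' N) = 0
  lusin_symm : ∀ N ⊆ Ω, volume N = 0 → volume (γ.symm '' N) = 0
  eq_self : ∀ x ∈ Ω \ U, γ x = x

/-- The pushforward `γ_# u = u ∘ γ⁻¹`. -/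
def pushforward (γ : PartialEquiv (Eu m) (Eu m)) (u : Eu m → ℝ) : Eu m → ℝ := u ∘ γ.symm

/-- The Jacobian `J_m γ(x) = √det(L* L)`, where `L` is the Fréchet derivative of `γ` at `x`. -/
def jacobian (γ : PartialEquiv (Eu m) (Eu m)) (x : Eu m) : ℝ :=
  √(ContinuousLinearMap.adjoint (fderiv ℝ γ x) ∘L fderiv ℝ γ x).det

/-- `∇γ⁻¹(γ(x))`.  Gradients have the components as columns, so this is the adjoint (transpose)
of the Fréchet derivative. -/
def invGrad (γ : PartialEquiv (Eu m) (Eu m)) (x : Eu m) : Eu m →L[ℝ] Eu m :=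
  ContinuousLinearMap.adjoint (fderiv ℝ γ.symm (γ x))

/-- `∇γ⁻¹(γ(x)) J_m γ(x)`. -/
def lipJac (γ : PartialEquiv (Eu m) (Eu m)) (x : Eu m) : Eu m →L[ℝ] Eu m :=
  jacobian γ x • invGrad γ x

/-! The derivatives exist almost everywhere, so the suprema over `x ∈ Ω` are essential suprema.  All
the functions below are bounded on `Ω` when `γ` and `γ⁻¹` are Lipschitz on `Ω`. -/

/-- `ess sup_x sup_{‖v‖ = 1} (‖L₁(x) v‖ + ‖L₂(x) v‖ - 2 ‖v‖)`, with `L_i = lipJac γ_i`. -/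
def biG (Ω : Set (Eu m)) (γ₁ γ₂ : PartialEquiv (Eu m) (Eu m)) : ℝ :=
  essSup (fun x => ⨆ v : Metric.sphere (0 : Eu m) 1,
    (‖lipJac γ₁ x v‖ + ‖lipJac γ₂ x v‖ - 2 * ‖(v : Eu m)‖)) (volume.restrict Ω)

/-- `ess sup_x |J_m γ₁(x) + J_m γ₂(x) - 2|`. -/
def biJ (Ω : Set (Eu m)) (γ₁ γ₂ : PartialEquiv (Eu m) (Eu m)) : ℝ :=
  essSup (fun x => |jacobian γ₁ x + jacobian γ₂ x - 2|) (volume.restrict Ω)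

/-- The distance to the identity `ess sup_x ‖∇γ⁻¹(γ(x)) - I‖`. -/
def distId (Ω : Set (Eu m)) (γ : PartialEquiv (Eu m) (Eu m)) : ℝ :=
  essSup (fun x => ‖invGrad γ x - ContinuousLinearMap.id ℝ (Eu m)‖) (volume.restrict Ω)

/-- The double-Lipschitz comparison constant. -/
def biT (Ω : Set (Eu m)) (γ₁ γ₂ : PartialEquiv (Eu m) (Eu m)) : ℝ :=
  biG Ω γ₁ γ₂ + biJ Ω γ₁ γ₂ + distId Ω γ₁ ^ 2 + distId Ω γ₂ ^ 2

/-- `|Du|(A)`, for `μ = Du` on `Ω` and a Borel set `A ⊆ ℝ^m`; it means `|Du|(A ∩ Ω)`. -/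
def varOn {Ω : Set (Eu m)} (μ : VectorMeasure Ω (Eu m)) (A : Set (Eu m)) : ℝ≥0∞ :=
  μ.variation ((↑) ⁻¹' A)

/-- `R` is double-Lipschitz comparable. -/
def IsDoubleLipschitzComparable (Ω : Set (Eu m)) (R : (Eu m → ℝ) → ℝ≥0∞) : Prop :=
  ∃ Ra : ℝ, 0 ≤ Ra ∧
    ∀ (u : Eu m → ℝ) (Du : VectorMeasure Ω (Eu m)), IntegrableOn u Ω → HasGradientMeasure Ω u Du →
    ∀ U : Set (Eu m), IsOpen U → U ⊆ Ω →
    ∀ γ₁ γ₂ : PartialEquiv (Eu m) (Eu m), IsLipTransform Ω U γ₁ → IsLipTransform Ω U γ₂ →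
      biT Ω γ₁ γ₂ < 1 →
      (R (pushforward γ₁ u) : EReal) + R (pushforward γ₂ u) - 2 * R u
        ≤ (Ra : EReal) * (biT Ω γ₁ γ₂ : ℝ) * varOn Du (closure U)

/-- `Γ` is a Lipschitz `(m-1)`-graph `{v + f(v) z | v ∈ V}` with `z` a unit vector,
`V ⊆ z^⊥` relatively open and `f : V → ℝ` Lipschitz. -/
def IsLipschitzGraph (Γ : Set (Eu m)) : Prop :=
  ∃ z : Eu m, ‖z‖ = 1 ∧ ∃ (V : Set (ℝ ∙ z)ᗮ) (f : (ℝ ∙ z)ᗮ → ℝ), IsOpen V ∧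
    (∃ L : ℝ≥0, LipschitzOnWith L f V) ∧ Γ = (fun v : (ℝ ∙ z)ᗮ => (v : Eu m) + f v • z) '' V

/-- `R` is separably double-Lipschitz comparable.  That the pushforwards `γ_# u` are again in
`BV(Ω)`, so that `|Dγ_# u|` makes sense, is part of the requirement. -/
def IsSeparablyDoubleLipschitzComparable (Ω : Set (Eu m)) (R : (Eu m → ℝ) → ℝ≥0∞) : Prop :=
  ∃ Ra Rs : ℝ, 0 ≤ Ra ∧ 0 ≤ Rs ∧
    ∀ (u : Eu m → ℝ) (Du : VectorMeasure Ω (Eu m)), IntegrableOn u Ω → HasGradientMeasure Ω u Du →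
    ∀ U : Set (Eu m), IsOpen U → U ⊆ Ω →
    ∀ γ₁ γ₂ : PartialEquiv (Eu m) (Eu m), IsLipTransform Ω U γ₁ → IsLipTransform Ω U γ₂ →
      biT Ω γ₁ γ₂ < 1 →
    ∀ Γ : Set (Eu m), IsLipschitzGraph Γ →
    ∃ D₁ D₂ : VectorMeasure Ω (Eu m),
      HasGradientMeasure Ω (pushforward γ₁ u) D₁ ∧ HasGradientMeasure Ω (pushforward γ₂ u) D₂ ∧
      (R (pushforward γ₁ u) : EReal) + R (pushforward γ₂ u) - 2 * R u
        ≤ (Ra : EReal) * (biT Ω γ₁ γ₂ : ℝ) * varOn Du (closure U \ Γ)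
          + (Rs : EReal) * ((varOn D₁ (γ₁ '' (Γ ∩ Ω)) : EReal) + varOn D₂ (γ₂ '' (Γ ∩ Ω))
              - 2 * varOn Du Γ)

/-! ### The regularisation problem -/

/-- `φ(x) - φ(y) ≤ C (|x| - |y|) |x|^(p-1)` for some `C > 0` and all real `x`, `y`. -/
def IsPIncreasing (p : ℝ) (φ : ℝ → ℝ≥0∞) : Prop :=
  ∃ C : ℝ, 0 < C ∧ ∀ x y : ℝ,
    (φ x : EReal) ≤ φ y + ((C * (|x| - |y|) * |x| ^ (p - 1) : ℝ) : EReal)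

/-- `u ∈ L¹(Ω)` minimises `∫_Ω φ(f - u) dx + R(u)` over `L¹(Ω)`. -/
def IsSolution (Ω : Set (Eu m)) (φ : ℝ → ℝ≥0∞) (R : (Eu m → ℝ) → ℝ≥0∞) (f u : Eu m → ℝ) : Prop :=
  IntegrableOn u Ω ∧ ∀ v : Eu m → ℝ, IntegrableOn v Ω →
    (∫⁻ x in Ω, φ (f x - u x)) + R u ≤ (∫⁻ x in Ω, φ (f x - v x)) + R v

end TVReg

end

noncomputable section

namespace TVReg

variable {m : ℕ}

/-! ### Divergence and integration by parts -/

/-! Everything rests on duality. `TV` is a supremum of the linear functionals u ↦ ∫ u div φ, each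
continuous on L¹ because div φ is bounded. Convexity and lower semicontinuity follow at once, and
coercivity holds with C = 1/α.

For comparability, the change of variables turns ∫ (γ_#u) div φ into ∫ u Jγ (div φ)∘γ. By the Piola
identity (`IsLipTransform.hasWeakDiv_pull`) the factor Jγ (div φ)∘γ is the distributional divergence
of L_γ*(φ∘γ). Two test fields φ₁, φ₂ for the two push-forwards thus produce one field Φ = L₁*(φ₁∘γ₁)
+ L₂*(φ₂∘γ₂) for u. Since ⟨Φ, v⟩ ≤ ‖L₁v‖ + ‖L₂v‖ ≤ (2 + G)‖v‖, where G is the first term of T, one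
gets ‖Φ‖ ≤ 2 + G. The fields are added before the norm is taken, so deviations of L₁ and L₂ from the
identity may cancel. Φ is not smooth, but it has compact support and a bounded divergence, so
mollification makes it a competitor. This gives `TV_image_add_le` on every open A ⊆ Ω.

To pass to measures, `HasGradientMeasure.varOn_eq_TV` identifies |Du|(B) with the total variation on
open B, and `exists_hasGradientMeasure`, a Riesz representation in L², shows that push-forwards stay
in BV. Outer regularity then yields |Dγ₁#u|(γ₁(S)) + |Dγ₂#u|(γ₂(S)) ≤ (2 + G)|Du|(S) for all S. Away
from the closure of U both maps are the identity, so no excess arises there; this is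
`pullVar_real_add_sub_le`. Taking S = Ω gives double-Lipschitz comparability. Taking S = Ω \ Γ gives
the separable version, because the mass on Γ appears unchanged on the right. All constants equal α.

For the L^∞ bound, u is compared with its truncation to [-M, M], M = ‖f‖_∞. Truncation does not
increase `TV` (`TV_clamp_le`), because a 1-Lipschitz map does not increase gradients of smooth
approximations. It brings u closer to f, strictly so where |u| > M. As φ is strictly increasing in
|x| where finite, minimality forces that set to be null. -/

lemma fderiv_coord {φ : Eu m → Eu m} {x : Eu m} (hφ : DifferentiableAt ℝ φ x) (i : Fin m)
    (v : Eu m) : fderiv ℝ (fun y => φ y i) x v = (fderiv ℝ φ x v) i := by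
  have h := (EuclideanSpace.proj (𝕜 := ℝ) i).hasFDerivAt.comp x hφ.hasFDerivAt
  have h' : HasFDerivAt (fun y => φ y i)
      ((EuclideanSpace.proj (𝕜 := ℝ) i).comp (fderiv ℝ φ x)) x := h
  rw [h'.fderiv]
  simp

lemma eq_sum_single (v : Eu m) : v = ∑ i, v i • EuclideanSpace.single i (1 : ℝ) := by
  ext j
  simp [Pi.single_apply]

lemma continuous_divergence {φ : Eu m → Eu m} (hφ : ContDiff ℝ ∞ φ) :
    Continuous (divergence φ) := by
  have h : Continuous (fderiv ℝ φ) := hφ.continuous_fderiv (by simp)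
  unfold divergence
  fun_prop

lemma divergence_eq_zero {φ : Eu m → Eu m} {x : Eu m} (hx : x ∉ tsupport φ) :
    divergence φ x = 0 := by
  have h : fderiv ℝ φ x = 0 := by
    by_contra h
    exact hx (support_fderiv_subset ℝ h)
  simp [divergence, h]

lemma tsupport_divergence_subset (φ : Eu m → Eu m) : tsupport (divergence φ) ⊆ tsupport φ :=
  closure_minimal (fun x hx => by
    by_contra h
    exact hx (divergence_eq_zero h)) (isClosed_tsupport φ)

lemma hasCompactSupport_divergence {φ : Eu m → Eu m} (hφ : HasCompactSupport φ) :
    HasCompactSupport (divergence φ) :=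
  hφ.of_isClosed_subset (isClosed_tsupport _) (tsupport_divergence_subset φ)

lemma divergence_const_smul (c : ℝ) {φ : Eu m → Eu m} (hφ : ContDiff ℝ ∞ φ) (x : Eu m) :
    divergence (fun y => c • φ y) x = c * divergence φ x := by
  have h : fderiv ℝ (fun y => c • φ y) x = c • fderiv ℝ φ x :=
    fderiv_fun_const_smul (hφ.differentiable (by simp) x) c
  simp [divergence, h, Finset.mul_sum]

lemma divergence_add {φ χ : Eu m → Eu m} (hφ : ContDiff ℝ ∞ φ) (hχ : ContDiff ℝ ∞ χ) (x : Eu m) :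
    divergence (fun y => φ y + χ y) x = divergence φ x + divergence χ x := by
  have h : fderiv ℝ (fun y => φ y + χ y) x = fderiv ℝ φ x + fderiv ℝ χ x :=
    fderiv_fun_add (hφ.differentiable (by simp) x) (hχ.differentiable (by simp) x)
  simp [divergence, h, Finset.sum_add_distrib]

lemma divergence_smul_const {ψ : Eu m → ℝ} (hψ : ContDiff ℝ ∞ ψ) (e : Eu m) (x : Eu m) :
    divergence (fun y => ψ y • e) x = fderiv ℝ ψ x e := by
  have h : fderiv ℝ (fun y => ψ y • e) x = (fderiv ℝ ψ x).smulRight e :=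
    ((hψ.differentiable (by simp) x).hasFDerivAt.smul_const e).fderiv
  conv_rhs => rw [eq_sum_single e]
  simp [divergence, h, mul_comm]

lemma exists_lipschitzWith {F : Type*} [NormedAddCommGroup F] [NormedSpace ℝ F]
    {f : Eu m → F} (hf : ContDiff ℝ ∞ f) (hc : HasCompactSupport f) : ∃ K, LipschitzWith K f :=
  ContDiff.lipschitzWith_of_hasCompactSupport hc hf (by simp)

/-- Integration by parts of a Lipschitz function against a smooth vector field. -/
lemma integral_lipschitz_mul_divergence {w : Eu m → ℝ} {K : ℝ≥0} (hw : LipschitzWith K w)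
    {φ : Eu m → Eu m} (hφ : ContDiff ℝ ∞ φ) (hc : HasCompactSupport φ) :
    ∫ x, w x * divergence φ x = -∫ x, fderiv ℝ w x (φ x) := by
  have hcoord : ∀ i, ContDiff ℝ ∞ (fun x => φ x i) := fun i =>
    (EuclideanSpace.proj (𝕜 := ℝ) i).contDiff.comp hφ
  have hcs : ∀ i, HasCompactSupport (fun x => φ x i) := fun i =>
    hc.comp_left (g := fun v : Eu m => v i) rfl
  have hdφ : ∀ x i, fderiv ℝ (fun y => φ y i) x (EuclideanSpace.single i 1)
      = (fderiv ℝ φ x (EuclideanSpace.single i 1)) i := fun x i =>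
    fderiv_coord (hφ.differentiable (by simp) x) i _
  have hi : ∀ i, ∫ x, w x * (fderiv ℝ φ x (EuclideanSpace.single i 1)) i
      = -∫ x, lineDeriv ℝ w x (EuclideanSpace.single i 1) * φ x i := by
    intro i
    obtain ⟨D, hD⟩ := exists_lipschitzWith (hcoord i) (hcs i)
    rw [hw.integral_lineDeriv_mul_eq hD (hcs i), ← integral_neg]
    congr 1 with x
    rw [((hcoord i).differentiable (by simp) x).lineDeriv_eq_fderiv, map_neg, hdφ]
    ring
  have hint1 : ∀ i ∈ Finset.univ,
      Integrable (fun x => w x * (fderiv ℝ φ x (EuclideanSpace.single i 1)) i) := by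
    intro i _
    have h : Continuous (fderiv ℝ φ) := hφ.continuous_fderiv (by simp)
    refine Continuous.integrable_of_hasCompactSupport ?_ ?_
    · have := hw.continuous
      fun_prop
    · refine HasCompactSupport.mul_left ?_
      refine (hc.fderiv ℝ).comp_left
        (g := fun L : Eu m →L[ℝ] Eu m => (L (EuclideanSpace.single i 1)) i) ?_
      simp
  have hint2 : ∀ i ∈ Finset.univ,
      Integrable (fun x => lineDeriv ℝ w x (EuclideanSpace.single i 1) * φ x i) := by
    intro i _
    have h1 : Integrable (fun x => φ x i) :=
      (hcoord i).continuous.integrable_of_hasCompactSupport (hcs i)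
    refine h1.bdd_mul (c := K * ‖EuclideanSpace.single i (1 : ℝ)‖) ?_ ?_
    · exact (measurable_lineDeriv hw.continuous).aestronglyMeasurable
    · exact Eventually.of_forall fun x => norm_lineDeriv_le_of_lipschitz ℝ hw
  simp only [divergence, Finset.mul_sum]
  rw [integral_finsetSum _ hint1]
  simp only [hi]
  rw [Finset.sum_neg_distrib, ← integral_finsetSum _ hint2]
  congr 1
  refine integral_congr_ae ?_
  -- By Rademacher, the coordinate line derivatives assemble into the Fréchet derivative at almost
  -- every point.
  filter_upwards [hw.ae_differentiableAt] with x hx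
  conv_rhs => rw [eq_sum_single (φ x)]
  simp only [map_sum, map_smul, smul_eq_mul, hx.lineDeriv_eq_fderiv]
  exact Finset.sum_congr rfl fun i _ => mul_comm _ _

/-! ### Elementary properties of the total variation -/

lemma isTestField_zero (Ω : Set (Eu m)) : IsTestField Ω (fun _ => 0) where
  contDiff := contDiff_const
  hasCompactSupport := HasCompactSupport.zero
  tsupport_subset := by
    have : tsupport (fun _ : Eu m => (0 : Eu m)) = ∅ := tsupport_eq_empty_iff.2 rfl
    simp [this]
  norm_le_one := by simp

lemma divergence_zero (x : Eu m) : divergence (fun _ : Eu m => (0 : Eu m)) x = 0 := by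
  simp [divergence]

lemma exists_bound_divergence {φ : Eu m → Eu m} (hφ : ContDiff ℝ ∞ φ) (hc : HasCompactSupport φ) :
    ∃ C, ∀ x, ‖divergence φ x‖ ≤ C :=
  (hasCompactSupport_divergence hc).exists_bound_of_continuous (continuous_divergence hφ)

lemma integrable_mul_divergence {μ : Measure (Eu m)} {u : Eu m → ℝ}
    (hu : Integrable u μ) {φ : Eu m → Eu m} (hφ : ContDiff ℝ ∞ φ) (hc : HasCompactSupport φ) :
    Integrable (fun x => u x * divergence φ x) μ := by
  obtain ⟨C, hC⟩ := exists_bound_divergence hφ hc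
  exact hu.mul_bdd (c := C) (continuous_divergence hφ).aestronglyMeasurable
    (Eventually.of_forall hC)

lemma le_TV {Ω : Set (Eu m)} (u : Eu m → ℝ) {φ : Eu m → Eu m} (hφ : IsTestField Ω φ) :
    ENNReal.ofReal (∫ x in Ω, u x * divergence φ x) ≤ TV Ω u :=
  le_iSup₂ (f := fun (φ : Eu m → Eu m) (_ : IsTestField Ω φ) =>
    ENNReal.ofReal (∫ x in Ω, u x * divergence φ x)) φ hφ

/-- The pairing with a compactly supported field bounded by `c` is at most `c TV(u)`. -/
lemma ofReal_integral_le_mul_TV {Ω : Set (Eu m)} (u : Eu m → ℝ) {φ : Eu m → Eu m} {c : ℝ}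
    (hφ : ContDiff ℝ ∞ φ) (hcs : HasCompactSupport φ) (hs : tsupport φ ⊆ Ω)
    (hc : ∀ x, ‖φ x‖ ≤ c) :
    ENNReal.ofReal (∫ x in Ω, u x * divergence φ x) ≤ ENNReal.ofReal c * TV Ω u := by
  have hc0 : 0 ≤ c := (norm_nonneg _).trans (hc 0)
  rcases hc0.eq_or_lt with rfl | hpos
  · have : φ = fun _ => 0 := by
      ext1 x
      exact norm_le_zero_iff.1 (hc x)
    subst this
    simp [divergence_zero]
  · have ht : IsTestField Ω (fun x => c⁻¹ • φ x) := by
      refine ⟨hφ.const_smul c⁻¹, hcs.smul_left (f := fun _ => c⁻¹), ?_, fun x => ?_⟩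
      · exact (closure_mono (Function.support_const_smul_subset c⁻¹ φ)).trans hs
      · rw [norm_smul, norm_inv, Real.norm_of_nonneg hc0, inv_mul_le_one₀ hpos]
        exact hc x
    have h := le_TV u ht
    simp only [divergence_const_smul _ hφ] at h
    have he : ∫ x in Ω, u x * divergence φ x
        = c * ∫ x in Ω, u x * (c⁻¹ * divergence φ x) := by
      rw [← integral_const_mul]
      congr 1 with x
      field_simp
    rw [he, ENNReal.ofReal_mul hc0]
    gcongr

/-- A negative pairing is cut to zero by `ENNReal.ofReal`, so the zero field does as well. With
nonnegative pairings, `ENNReal.ofReal` becomes additive, as is needed when two suprema are added. -/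
lemma exists_testField_nonneg {Ω : Set (Eu m)} (u : Eu m → ℝ) {φ : Eu m → Eu m}
    (hφ : IsTestField Ω φ) :
    ∃ χ, IsTestField Ω χ ∧ 0 ≤ ∫ x in Ω, u x * divergence χ x ∧
      ENNReal.ofReal (∫ x in Ω, u x * divergence φ x)
        = ENNReal.ofReal (∫ x in Ω, u x * divergence χ x) := by
  rcases le_total 0 (∫ x in Ω, u x * divergence φ x) with h | h
  · exact ⟨φ, hφ, h, rfl⟩
  · exact ⟨_, isTestField_zero Ω, by simp [divergence_zero], by
      simp [divergence_zero, ENNReal.ofReal_of_nonpos h]⟩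

lemma TV_congr_ae {Ω : Set (Eu m)} {u v : Eu m → ℝ} (h : u =ᵐ[volume.restrict Ω] v) :
    TV Ω u = TV Ω v := by
  unfold TV
  congr! 3 with φ hφ
  congr 1
  refine integral_congr_ae ?_
  filter_upwards [h] with x hx
  rw [hx]

lemma TV_convex {Ω : Set (Eu m)} {u v : Eu m → ℝ} (hu : IntegrableOn u Ω) (hv : IntegrableOn v Ω)
    (a b : ℝ≥0) : TV Ω (fun x => a * u x + b * v x) ≤ a * TV Ω u + b * TV Ω v := by
  refine iSup₂_le fun φ hφ => ?_
  have h : ∫ x in Ω, (a * u x + b * v x) * divergence φ x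
      = a * (∫ x in Ω, u x * divergence φ x) + b * ∫ x in Ω, v x * divergence φ x := by
    rw [← integral_const_mul, ← integral_const_mul, ← integral_add]
    · congr 1 with x
      ring
    · exact (integrable_mul_divergence hu hφ.contDiff hφ.hasCompactSupport).const_mul _
    · exact (integrable_mul_divergence hv hφ.contDiff hφ.hasCompactSupport).const_mul _
  rw [h]
  refine ENNReal.ofReal_add_le.trans ?_
  rw [ENNReal.ofReal_mul a.coe_nonneg, ENNReal.ofReal_mul b.coe_nonneg, ENNReal.ofReal_coe_nnreal,
    ENNReal.ofReal_coe_nnreal]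
  gcongr
  · exact le_TV u hφ
  · exact le_TV v hφ

/-- A supremum of L¹-continuous functionals is lower semicontinuous; strong L¹ convergence alone
suffices. -/
lemma TV_le_liminf {Ω : Set (Eu m)} {u : ℕ → Eu m → ℝ} {v : Eu m → ℝ}
    (hu : ∀ k, IntegrableOn (u k) Ω) (hv : IntegrableOn v Ω)
    (h : Tendsto (fun k => ∫ x in Ω, |u k x - v x|) atTop (𝓝 0)) :
    TV Ω v ≤ liminf (fun k => TV Ω (u k)) atTop := by
  refine iSup₂_le fun φ hφ => ?_
  obtain ⟨C, hC⟩ := exists_bound_divergence hφ.contDiff hφ.hasCompactSupport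
  have hlim : Tendsto (fun k => ∫ x in Ω, u k x * divergence φ x) atTop
      (𝓝 (∫ x in Ω, v x * divergence φ x)) := by
    rw [tendsto_iff_norm_sub_tendsto_zero]
    have h0 : Tendsto (fun k => C * ∫ x in Ω, |u k x - v x|) atTop (𝓝 0) := by
      simpa using h.const_mul C
    refine squeeze_zero (fun _ => norm_nonneg _) (fun k => ?_) h0
    rw [← integral_sub (integrable_mul_divergence (hu k) hφ.contDiff hφ.hasCompactSupport)
      (integrable_mul_divergence hv hφ.contDiff hφ.hasCompactSupport), ← integral_const_mul]
    refine norm_integral_le_of_norm_le (((hu k).sub hv).abs.const_mul C) ?_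
    refine Eventually.of_forall fun x => ?_
    rw [← sub_mul, norm_mul, mul_comm]
    exact mul_le_mul_of_nonneg_right (hC x) (norm_nonneg _)
  have hlim' := (ENNReal.continuous_ofReal.tendsto _).comp hlim
  rw [← hlim'.liminf_eq]
  exact liminf_le_liminf (Eventually.of_forall fun k => le_TV (u k) hφ)

theorem isAdmissible_TV {Ω : Set (Eu m)} {α : ℝ} (hα : 0 < α) :
    IsAdmissible Ω (fun u => ENNReal.ofReal α * TV Ω u) where
  congr_ae u v _ _ h := by simp only [TV_congr_ae h]
  convex u v hu hv a b _ := by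
    refine (mul_le_mul_right (TV_convex hu hv a b) _).trans_eq ?_
    ring
  lsc u v h := by
    obtain ⟨hu, hv, hlim, -⟩ := h
    rw [ENNReal.liminf_const_mul_of_ne_zero_of_ne_top (by simpa using hα) ENNReal.ofReal_ne_top]
    exact mul_le_mul_right (TV_le_liminf hu hv hlim) _
  coercive := by
    refine ⟨Real.toNNReal α⁻¹, by simpa using hα, fun u _ => ?_⟩
    have h : (Real.toNNReal α⁻¹ : ℝ≥0∞) * ENNReal.ofReal α = 1 := by
      change ENNReal.ofReal α⁻¹ * ENNReal.ofReal α = 1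
      rw [← ENNReal.ofReal_mul (by positivity), inv_mul_cancel₀ hα.ne', ENNReal.ofReal_one]
    calc TV Ω u = Real.toNNReal α⁻¹ * (ENNReal.ofReal α * TV Ω u) := by
          rw [← mul_assoc, h, one_mul]
      _ ≤ _ := by
          gcongr
          exact le_add_self

/-! ### Mollification -/

/-- A sequence of smooth bumps at the origin whose supports shrink to the origin. -/
def bump (m k : ℕ) : ContDiffBump (0 : Eu m) where
  rIn := 1 / (k + 1) / 2
  rOut := 1 / (k + 1)
  rIn_pos := by positivity
  rIn_lt_rOut := half_lt_self (by positivity)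

/-- The mollifying kernels, of integral one and supported in the balls of radius `1 / (k + 1)`. -/
def kern (m k : ℕ) : Eu m → ℝ := (bump m k).normed volume

/-- The mollification of `f` with the kernel `kern m k`. -/
def mollify {F : Type*} [NormedAddCommGroup F] [NormedSpace ℝ F] (k : ℕ) (f : Eu m → F) :
    Eu m → F :=
  convolution (kern m k) f (ContinuousLinearMap.lsmul ℝ ℝ) volume

lemma contDiff_kern (k : ℕ) : ContDiff ℝ ∞ (kern m k) := (bump m k).contDiff_normed

lemma hasCompactSupport_kern (k : ℕ) : HasCompactSupport (kern m k) :=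
  (bump m k).hasCompactSupport_normed

lemma kern_nonneg (k : ℕ) (x : Eu m) : 0 ≤ kern m k x := (bump m k).nonneg_normed x

lemma kern_neg (k : ℕ) (x : Eu m) : kern m k (-x) = kern m k x := (bump m k).normed_neg x

lemma kern_eq_zero {k : ℕ} {x : Eu m} (hx : 1 / ((k : ℝ) + 1) ≤ ‖x‖) : kern m k x = 0 := by
  by_contra h
  have h' : x ∈ Function.support ((bump m k).normed volume) := h
  rw [ContDiffBump.support_normed_eq] at h'
  simp only [Metric.mem_ball, dist_zero_right] at h'
  exact absurd h' (not_lt.2 hx)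

lemma integral_kern_sub (k : ℕ) (x : Eu m) : ∫ t, kern m k (x - t) = 1 := by
  rw [integral_sub_left_eq_self]
  exact (bump m k).integral_normed

lemma tendsto_radius : Tendsto (fun k => (bump m k).rOut) atTop (𝓝 0) :=
  tendsto_one_div_add_atTop_nhds_zero_nat

/-- The reflected and translated kernel `t ↦ kern m k (x - t)`, with its derivative. -/
lemma fderiv_kern_sub (k : ℕ) (x t : Eu m) :
    fderiv ℝ (fun s => kern m k (x - s)) t = -fderiv ℝ (kern m k) (x - t) := by
  have h := ((contDiff_kern k).differentiable (by simp) (x - t)).hasFDerivAt.comp t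
    ((hasFDerivAt_const x t).sub (hasFDerivAt_id t))
  refine h.fderiv.trans ?_
  ext v
  simp

lemma contDiff_kern_sub (k : ℕ) (x : Eu m) : ContDiff ℝ ∞ (fun s => kern m k (x - s)) :=
  (contDiff_kern k).comp (contDiff_const.sub contDiff_id)

lemma hasCompactSupport_kern_sub (k : ℕ) (x : Eu m) :
    HasCompactSupport (fun s => kern m k (x - s)) :=
  (hasCompactSupport_kern k).comp_homeomorph (Homeomorph.subLeft x)

lemma fderiv_kern_neg (k : ℕ) (x : Eu m) :
    fderiv ℝ (kern m k) (-x) = -fderiv ℝ (kern m k) x := by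
  have h : (fun s => kern m k (0 - s)) = kern m k := by
    ext s
    rw [zero_sub, kern_neg]
  have := fderiv_kern_sub k 0 x
  rw [h, zero_sub] at this
  rw [this, neg_neg]

section

variable {F : Type*} [NormedAddCommGroup F] [NormedSpace ℝ F]

lemma mollify_apply (k : ℕ) (f : Eu m → F) (x : Eu m) :
    mollify k f x = ∫ t, kern m k (x - t) • f t := by
  rw [mollify, convolution_eq_swap]
  simp

lemma integrable_kern_smul (k : ℕ) {f : Eu m → F} (hf : LocallyIntegrable f) (x : Eu m) :
    Integrable (fun t => kern m k (x - t) • f t) :=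
  hf.integrable_smul_left_of_hasCompactSupport (contDiff_kern_sub k x).continuous
    (hasCompactSupport_kern_sub k x)

lemma contDiff_mollify [CompleteSpace F] (k : ℕ) {f : Eu m → F} (hf : LocallyIntegrable f) :
    ContDiff ℝ ∞ (mollify k f) :=
  (hasCompactSupport_kern k).contDiff_convolution_left _ (contDiff_kern k) hf

lemma fderiv_mollify [CompleteSpace F] (k : ℕ) {f : Eu m → F} (hf : LocallyIntegrable f)
    (x v : Eu m) :
    fderiv ℝ (mollify k f) x v = ∫ t, fderiv ℝ (kern m k) (x - t) v • f t := by
  have h := (hasCompactSupport_kern (m := m) k).hasFDerivAt_convolution_left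
    (ContinuousLinearMap.lsmul ℝ ℝ) ((contDiff_kern k).of_le (by simp)) hf x
  rw [mollify, h.fderiv, convolution_eq_swap, ContinuousLinearMap.integral_apply]
  · simp
  · have h1 := ((hasCompactSupport_kern (m := m) k).fderiv ℝ).convolutionExists_left
      ((ContinuousLinearMap.lsmul ℝ ℝ).precompL (Eu m) :
        (Eu m →L[ℝ] ℝ) →L[ℝ] F →L[ℝ] Eu m →L[ℝ] F)
      ((contDiff_kern k).continuous_fderiv (by simp)) hf x
    exact h1.integrable_swap

lemma mollify_eq_zero {k : ℕ} {f : Eu m → F} {K : Set (Eu m)} (hf : ∀ x ∉ K, f x = 0)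
    {x : Eu m} (hx : x ∉ Metric.cthickening (1 / ((k : ℝ) + 1)) K) : mollify k f x = 0 := by
  rw [mollify_apply]
  refine integral_eq_zero_of_ae (Eventually.of_forall fun t => ?_)
  by_cases ht : t ∈ K
  · have : kern m k (x - t) = 0 := by
      refine kern_eq_zero ?_
      by_contra h
      refine hx (Metric.mem_cthickening_of_dist_le x t _ K ht ?_)
      rw [dist_eq_norm]
      exact (not_le.1 h).le
    simp [this]
  · simp [hf t ht]

lemma tsupport_mollify_subset {k : ℕ} {f : Eu m → F} {K : Set (Eu m)} (hf : ∀ x ∉ K, f x = 0) :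
    tsupport (mollify k f) ⊆ Metric.cthickening (1 / ((k : ℝ) + 1)) K :=
  closure_minimal (fun x hx => by
    by_contra h
    exact hx (mollify_eq_zero hf h)) Metric.isClosed_cthickening

lemma hasCompactSupport_mollify {k : ℕ} {f : Eu m → F} {K : Set (Eu m)} (hK : IsCompact K)
    (hf : ∀ x ∉ K, f x = 0) : HasCompactSupport (mollify k f) :=
  hK.cthickening.of_isClosed_subset (isClosed_tsupport _) (tsupport_mollify_subset hf)

lemma eventually_tsupport_mollify_subset {K A : Set (Eu m)} (hK : IsCompact K) (hA : IsOpen A)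
    (hKA : K ⊆ A) :
    ∀ᶠ k : ℕ in atTop, ∀ f : Eu m → F, (∀ x ∉ K, f x = 0) → tsupport (mollify k f) ⊆ A := by
  obtain ⟨δ, hδ, h⟩ := hK.exists_cthickening_subset_open hA hKA
  filter_upwards [tendsto_one_div_add_atTop_nhds_zero_nat.eventually_lt_const hδ] with k hk f hf
  exact (tsupport_mollify_subset hf).trans ((Metric.cthickening_mono hk.le K).trans h)

lemma norm_mollify_le (k : ℕ) {f : Eu m → F} {g : Eu m → ℝ} (hg : LocallyIntegrable g)
    (h : ∀ᵐ x, ‖f x‖ ≤ g x) (x : Eu m) : ‖mollify k f x‖ ≤ mollify k g x := by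
  rw [mollify_apply, mollify_apply]
  refine norm_integral_le_of_norm_le (integrable_kern_smul k hg x) ?_
  filter_upwards [h] with t ht
  rw [norm_smul, Real.norm_of_nonneg (kern_nonneg k _), smul_eq_mul]
  exact mul_le_mul_of_nonneg_left ht (kern_nonneg k _)

lemma mollify_const (k : ℕ) (c : ℝ) (x : Eu m) : mollify k (fun _ : Eu m => c) x = c := by
  rw [mollify_apply]
  simp only [smul_eq_mul]
  rw [integral_mul_const, integral_kern_sub, one_mul]

lemma norm_mollify_le_const (k : ℕ) {f : Eu m → F} {c : ℝ} (h : ∀ᵐ x, ‖f x‖ ≤ c) (x : Eu m) :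
    ‖mollify k f x‖ ≤ c :=
  (norm_mollify_le k (locallyIntegrable_const c) h x).trans_eq (mollify_const k c x)

lemma ae_tendsto_mollify [CompleteSpace F] {f : Eu m → F} (hf : LocallyIntegrable f) :
    ∀ᵐ x, Tendsto (fun k => mollify k f x) atTop (𝓝 (f x)) :=
  -- The outer radius is exactly twice the inner one; a bounded ratio is what the Lebesgue
  -- differentiation argument requires.
  ContDiffBump.ae_convolution_tendsto_right_of_locallyIntegrable (K := 2) tendsto_radius
    (Eventually.of_forall fun k => by
      change 1 / ((k : ℝ) + 1) ≤ 2 * (1 / (k + 1) / 2)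
      linarith) hf

lemma tendsto_mollify [CompleteSpace F] {f : Eu m → F} (hf : Continuous f) (x : Eu m) :
    Tendsto (fun k => mollify k f x) atTop (𝓝 (f x)) :=
  ContDiffBump.convolution_tendsto_right_of_continuous tendsto_radius hf x

end

/-! ### Weak divergences -/

/-- `h` is the distributional divergence of the vector field `Φ` on `ℝ^m`. -/
def HasWeakDiv (Φ : Eu m → Eu m) (h : Eu m → ℝ) : Prop :=
  ∀ ψ : Eu m → ℝ, ContDiff ℝ ∞ ψ → HasCompactSupport ψ →
    ∫ x, ψ x * h x = -∫ x, fderiv ℝ ψ x (Φ x)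

lemma divergence_mollify (k : ℕ) {Φ : Eu m → Eu m} (hΦ : LocallyIntegrable Φ) (x : Eu m) :
    divergence (mollify k Φ) x = ∫ t, fderiv ℝ (kern m k) (x - t) (Φ t) := by
  have hint : ∀ v : Eu m, Integrable (fun t => fderiv ℝ (kern m k) (x - t) v • Φ t) := by
    intro v
    refine hΦ.integrable_smul_left_of_hasCompactSupport ?_ ?_
    · have : Continuous (fderiv ℝ (kern m k)) := (contDiff_kern k).continuous_fderiv (by simp)
      fun_prop
    · exact (((hasCompactSupport_kern (m := m) k).fderiv ℝ).comp_left
        (g := fun L : Eu m →L[ℝ] ℝ => L v) rfl).comp_homeomorph (Homeomorph.subLeft x)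
  have hcoord : ∀ (v : Eu m) (i : Fin m), (∫ t, fderiv ℝ (kern m k) (x - t) v • Φ t) i
      = ∫ t, (fderiv ℝ (kern m k) (x - t) v • Φ t) i := fun v i =>
    ((EuclideanSpace.proj (𝕜 := ℝ) i).integral_comp_comm (hint v)).symm
  simp only [divergence, fderiv_mollify k hΦ, hcoord]
  rw [← integral_finsetSum]
  · congr 1 with t
    conv_rhs => rw [eq_sum_single (Φ t)]
    simp [mul_comm]
  · intro i _
    exact (EuclideanSpace.proj (𝕜 := ℝ) i).integrable_comp (hint _)

/-- The reflected kernel s ↦ `kern m k (x - s)` is itself a legitimate test function for the weak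
divergence. -/
lemma HasWeakDiv.divergence_mollify {Φ : Eu m → Eu m} {h : Eu m → ℝ} (H : HasWeakDiv Φ h)
    (hΦ : LocallyIntegrable Φ) (k : ℕ) (x : Eu m) :
    divergence (mollify k Φ) x = mollify k h x := by
  rw [TVReg.divergence_mollify k hΦ, mollify_apply]
  have := H _ (contDiff_kern_sub k x) (hasCompactSupport_kern_sub k x)
  simp only [smul_eq_mul]
  rw [this, ← integral_neg]
  simp only [fderiv_kern_sub, neg_apply, neg_neg]

/-- The pairing of an integrable function with bounded functions is continuous along
mollification. -/
lemma tendsto_integral_mul_mollify {A : Set (Eu m)} {u h : Eu m → ℝ} (hu : IntegrableOn u A)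
    {M : ℝ} (hint : LocallyIntegrable h) (hM : ∀ x, ‖h x‖ ≤ M) :
    Tendsto (fun k => ∫ x in A, u x * mollify k h x) atTop (𝓝 (∫ x in A, u x * h x)) := by
  refine tendsto_integral_of_dominated_convergence (fun x => ‖u x‖ * M) (fun k => ?_)
    (hu.norm.mul_const M) (fun k => ?_) ?_
  · exact hu.aestronglyMeasurable.mul
      (contDiff_mollify k hint).continuous.aestronglyMeasurable
  · refine Eventually.of_forall fun x => ?_
    rw [norm_mul]
    exact mul_le_mul_of_nonneg_left
      (norm_mollify_le_const k (Eventually.of_forall hM) x) (norm_nonneg _)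
  · filter_upwards [ae_restrict_of_ae (ae_tendsto_mollify hint)] with x hx
    exact hx.const_mul _

/-- A bounded field with bounded weak divergence and compact support in `A` may be used as a
competitor in the definition of the total variation on `A`. -/
lemma HasWeakDiv.ofReal_integral_le {Φ : Eu m → Eu m} {h : Eu m → ℝ} (H : HasWeakDiv Φ h)
    {A K : Set (Eu m)} (hA : IsOpen A) (hK : IsCompact K) (hKA : K ⊆ A)
    (hΦ0 : ∀ x ∉ K, Φ x = 0) (hΦ : LocallyIntegrable Φ)
    (hh : LocallyIntegrable h) {M c : ℝ} (hM : ∀ x, ‖h x‖ ≤ M) (hc : ∀ᵐ x, ‖Φ x‖ ≤ c)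
    {u : Eu m → ℝ} (hu : IntegrableOn u A) :
    ENNReal.ofReal (∫ x in A, u x * h x) ≤ ENNReal.ofReal c * TV A u := by
  have hlim := (ENNReal.continuous_ofReal.tendsto _).comp (tendsto_integral_mul_mollify hu hh hM)
  refine le_of_tendsto hlim ?_
  filter_upwards [eventually_tsupport_mollify_subset (F := Eu m) hK hA hKA] with k hk
  simp only [Function.comp_apply, ← H.divergence_mollify hΦ]
  exact ofReal_integral_le_mul_TV u (contDiff_mollify k hΦ) (hasCompactSupport_mollify hK hΦ0)
    (hk Φ hΦ0) (norm_mollify_le_const k hc)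

/-! ### Gradient measures -/

/-- In finite dimension the variation is dominated by the sum of the total variations of the
coordinate signed measures, which are finite. -/
instance isFiniteMeasure_variation {X : Type*} [MeasurableSpace X] (μ : VectorMeasure X (Eu m)) :
    IsFiniteMeasure μ.variation := by
  let c : Fin m → SignedMeasure X := fun i =>
    μ.mapRange (EuclideanSpace.proj (𝕜 := ℝ) i : Eu m →L[ℝ] ℝ).toLinearMap.toAddMonoidHom
      (EuclideanSpace.proj (𝕜 := ℝ) i).continuous
  have hle : μ.variation ≤ ∑ i, (c i).totalVariation := by
    refine VectorMeasure.variation_le_of_forall_enorm_le fun E hE => ?_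
    have h1 : ‖μ E‖ₑ ≤ ∑ i, ‖μ E i‖ₑ := by
      conv_lhs => rw [eq_sum_single (μ E)]
      refine (enorm_sum_le _ _).trans (Finset.sum_le_sum fun i _ => ?_)
      rw [enorm_smul]
      simp [enorm_eq_nnnorm]
    refine h1.trans ?_
    rw [Measure.finsetSum_apply]
    exact Finset.sum_le_sum fun i _ => SignedMeasure.enorm_le_totalVariation (c i) E
  exact isFiniteMeasure_of_le _ hle

/-- The Euclidean inner product as a bilinear pairing. -/
def pairing (m : ℕ) : Eu m →L[ℝ] Eu m →L[ℝ] ℝ := innerSL ℝ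

lemma pairing_apply (x y : Eu m) : pairing m x y = inner ℝ x y := rfl

lemma norm_pairing_le : ‖pairing m‖ ≤ 1 :=
  ContinuousLinearMap.opNorm_le_bound _ zero_le_one fun x => by
    rw [one_mul]
    exact ContinuousLinearMap.opNorm_le_bound _ (norm_nonneg _) fun y => norm_inner_le_norm x y

lemma integrable_of_bounded {X : Type*} [MeasurableSpace X] [TopologicalSpace X]
    [OpensMeasurableSpace X] {F : Type*} [NormedAddCommGroup F]
    [SecondCountableTopologyEither X F]
    (μ : Measure X) [IsFiniteMeasure μ] {f : X → F} (hf : Continuous f) {C : ℝ}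
    (hC : ∀ x, ‖f x‖ ≤ C) : Integrable f μ :=
  Integrable.of_bound hf.aestronglyMeasurable C (Eventually.of_forall hC)

/-- Links the two integrals in use: the vector-valued integral of a scalar function, which defines
the gradient measure, and the scalar integral of a vector field, which appears in duality with test
fields. -/
lemma inner_integral_smul {X : Type*} [MeasurableSpace X] (μ : VectorMeasure X (Eu m)) {f : X → ℝ}
    (hf : Integrable f μ.variation) (e : Eu m) :
    inner ℝ e (∫ᵛ x, f x ∂•μ) = ∫ᵛ x, f x • e ∂[pairing m; μ] := by
  have h1 := VectorMeasure.continuousLinearMap_apply_integral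
    (B := ContinuousLinearMap.lsmul ℝ ℝ) (C := pairing m e) hf
  have h2 := VectorMeasure.integral_continuousLinearMap_comp (B := pairing m)
    (C := (ContinuousLinearMap.id ℝ ℝ).smulRight e) hf
  rw [pairing_apply] at h1
  rw [h1]
  simp only [ContinuousLinearMap.smulRight_apply, ContinuousLinearMap.id_apply] at h2
  rw [h2]
  congr 1
  ext
  simp [pairing_apply]

lemma inner_gradient_right (ψ : Eu m → ℝ) (x e : Eu m) :
    inner ℝ e (∇ ψ x) = fderiv ℝ ψ x e := by
  rw [real_inner_comm, gradient, InnerProductSpace.toDual_symm_apply]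

lemma continuous_gradient {ψ : Eu m → ℝ} (hψ : ContDiff ℝ ∞ ψ) : Continuous (∇ ψ) :=
  (InnerProductSpace.toDual ℝ (Eu m)).symm.continuous.comp (hψ.continuous_fderiv (by simp))

lemma integrable_smul_gradient {ν : Measure (Eu m)} {u : Eu m → ℝ} (hu : Integrable u ν)
    {ψ : Eu m → ℝ} (hψ : ContDiff ℝ ∞ ψ) (hc : HasCompactSupport ψ) :
    Integrable (fun x => u x • ∇ ψ x) ν := by
  obtain ⟨C, hC⟩ := (hc.fderiv ℝ).exists_bound_of_continuous (hψ.continuous_fderiv (by simp))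
  refine hu.smul_bdd C (continuous_gradient hψ).aestronglyMeasurable
    (Eventually.of_forall fun x => ?_)
  rw [gradient, LinearIsometryEquiv.norm_map]
  exact hC x

section

variable {Ω : Set (Eu m)} {u : Eu m → ℝ} {μ : VectorMeasure Ω (Eu m)}

lemma integrable_coe_of_hasCompactSupport {F : Type*} [NormedAddCommGroup F]
    (ν : Measure Ω) [IsFiniteMeasure ν] {η : Eu m → F} (hη : Continuous η)
    (hc : HasCompactSupport η) : Integrable (fun x : Ω => η x) ν := by
  obtain ⟨C, hC⟩ := hc.exists_bound_of_continuous hη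
  exact integrable_of_bounded ν (hη.comp continuous_subtype_val) fun x => hC x

lemma HasGradientMeasure.integral_mul_fderiv (h : HasGradientMeasure Ω u μ)
    (hu : IntegrableOn u Ω) {ψ : Eu m → ℝ} (hψ : ContDiff ℝ ∞ ψ) (hc : HasCompactSupport ψ)
    (hs : tsupport ψ ⊆ Ω) (e : Eu m) :
    ∫ x in Ω, u x * fderiv ℝ ψ x e = -∫ᵛ x : Ω, ψ x • e ∂[pairing m; μ] := by
  rw [← inner_integral_smul μ (integrable_coe_of_hasCompactSupport _ hψ.continuous hc),
    ← inner_neg_right, ← h ψ hψ hc hs, ← integral_inner (integrable_smul_gradient hu hψ hc)]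
  simp only [inner_smul_right, inner_gradient_right]

/-- Integration by parts against a smooth vector field. -/
lemma HasGradientMeasure.integral_mul_divergence (h : HasGradientMeasure Ω u μ)
    (hu : IntegrableOn u Ω) {η : Eu m → Eu m} (hη : ContDiff ℝ ∞ η) (hc : HasCompactSupport η)
    (hs : tsupport η ⊆ Ω) :
    ∫ x in Ω, u x * divergence η x = -∫ᵛ x : Ω, η x ∂[pairing m; μ] := by
  have hcoord : ∀ i, ContDiff ℝ ∞ (fun x => η x i) := fun i =>
    (EuclideanSpace.proj (𝕜 := ℝ) i).contDiff.comp hη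
  have hcs : ∀ i, HasCompactSupport (fun x => η x i) := fun i =>
    hc.comp_left (g := fun v : Eu m => v i) rfl
  have hss : ∀ i, tsupport (fun x => η x i) ⊆ Ω := fun i =>
    (tsupport_comp_subset (g := fun v : Eu m => v i) rfl η).trans hs
  have h1 : ∀ x, divergence η x
      = ∑ i, fderiv ℝ (fun y => η y i) x (EuclideanSpace.single i 1) := fun x =>
    Finset.sum_congr rfl fun i _ => (fderiv_coord (hη.differentiable (by simp) x) i _).symm
  have h2 : ∀ x : Ω, η x = ∑ i, η x i • EuclideanSpace.single i (1 : ℝ) := fun x =>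
    eq_sum_single _
  simp only [h1, Finset.mul_sum]
  rw [integral_finsetSum]
  · simp only [h.integral_mul_fderiv hu (hcoord _) (hcs _) (hss _)]
    rw [Finset.sum_neg_distrib, ← VectorMeasure.integral_finsetSum]
    · congr 2
      ext1 x
      exact (h2 x).symm
    · intro i _
      exact (integrable_coe_of_hasCompactSupport _ (hcoord i).continuous (hcs i)).smul_const _
  · intro i _
    obtain ⟨C, hC⟩ := ((hcs i).fderiv ℝ).exists_bound_of_continuous
      ((hcoord i).continuous_fderiv (by simp))
    refine hu.mul_bdd (c := C * ‖EuclideanSpace.single i (1 : ℝ)‖) ?_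
      (Eventually.of_forall fun x => ?_)
    · have := (hcoord i).continuous_fderiv (by simp)
      fun_prop
    · exact (ContinuousLinearMap.le_opNorm _ _).trans
        (mul_le_mul_of_nonneg_right (hC x) (norm_nonneg _))

/-- The bound uses the pointwise size of the field integrated against |Du|, not just its supremum;
this is what later allows localisation and domination. -/
lemma HasGradientMeasure.abs_integral_mul_divergence_le (h : HasGradientMeasure Ω u μ)
    (hu : IntegrableOn u Ω) {η : Eu m → Eu m} (hη : ContDiff ℝ ∞ η) (hc : HasCompactSupport η)
    (hs : tsupport η ⊆ Ω) :
    |∫ x in Ω, u x * divergence η x| ≤ ∫ x : Ω, ‖η x‖ ∂μ.variation := by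
  rw [h.integral_mul_divergence hu hη hc hs, abs_neg]
  refine (VectorMeasure.norm_integral_le_integral_norm (B := pairing m)
    (f := fun x : Ω => η x) (μ := μ)).trans ?_
  exact mul_le_of_le_one_left (integral_nonneg fun _ => norm_nonneg _) norm_pairing_le

/-- A measurable set `B ⊆ Ω` is seen by the pairing on `B` and on `Ω` alike. -/
lemma setIntegral_mul_divergence_eq {B : Set (Eu m)} (hBΩ : B ⊆ Ω)
    (hΩ : MeasurableSet Ω) (u : Eu m → ℝ) {η : Eu m → Eu m} (hs : tsupport η ⊆ B) :
    ∫ x in B, u x * divergence η x = ∫ x in Ω, u x * divergence η x := by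
  refine (setIntegral_eq_of_subset_of_forall_sdiff_eq_zero hΩ hBΩ fun x hx => ?_).symm
  rw [divergence_eq_zero fun h => hx.2 (hs h), mul_zero]

lemma HasGradientMeasure.TV_le (h : HasGradientMeasure Ω u μ) (hu : IntegrableOn u Ω)
    (hΩ : IsOpen Ω) {B : Set (Eu m)} (hB : IsOpen B) (hBΩ : B ⊆ Ω) : TV B u ≤ varOn μ B := by
  refine iSup₂_le fun φ hφ => ?_
  rw [setIntegral_mul_divergence_eq hBΩ hΩ.measurableSet u hφ.tsupport_subset]
  have hBm : MeasurableSet ((↑) ⁻¹' B : Set Ω) := hB.measurableSet.preimage measurable_subtype_coe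
  refine ENNReal.ofReal_le_of_le_toReal ?_
  refine (le_abs_self _).trans ((h.abs_integral_mul_divergence_le hu hφ.contDiff
    hφ.hasCompactSupport (hφ.tsupport_subset.trans hBΩ)).trans ?_)
  have h1 : ∫ x : Ω, ((↑) ⁻¹' B : Set Ω).indicator (fun _ => (1 : ℝ)) x ∂μ.variation
      = (varOn μ B).toReal := by
    rw [integral_indicator hBm]
    simp [varOn, Measure.real]
  rw [← h1]
  refine integral_mono ?_ ?_ fun x => ?_
  · exact (integrable_coe_of_hasCompactSupport _ hφ.contDiff.continuous
      hφ.hasCompactSupport).norm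
  · exact (integrable_const _).indicator hBm
  · by_cases hx : (x : Eu m) ∈ B
    · have hx' : x ∈ ((↑) ⁻¹' B : Set Ω) := hx
      rw [indicator_of_mem hx']
      exact hφ.norm_le_one _
    · have hx' : x ∉ ((↑) ⁻¹' B : Set Ω) := hx
      rw [indicator_of_notMem hx', image_eq_zero_of_notMem_tsupport
        fun h => hx (hφ.tsupport_subset h), norm_zero]

end

/-- A smooth Urysohn function for a compact set in an open set. -/
lemma exists_smooth_urysohn {K U : Set (Eu m)} (hK : IsCompact K) (hU : IsOpen U) (hKU : K ⊆ U) :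
    ∃ ψ : Eu m → ℝ, ContDiff ℝ ∞ ψ ∧ HasCompactSupport ψ ∧ tsupport ψ ⊆ U ∧
      (∀ x ∈ K, ψ x = 1) ∧ ∀ x, ψ x ∈ Icc (0 : ℝ) 1 := by
  obtain ⟨L, hL, hKL, hLU⟩ := exists_compact_between hK hU hKU
  obtain ⟨f, hf0, hf1, hf⟩ := exists_contMDiffMap_zero_one_of_isClosed (n := (⊤ : ℕ∞))
    (modelWithCornersSelf ℝ (Eu m)) (isOpen_interior (s := L)).isClosed_compl hK.isClosed
    (disjoint_compl_left_iff_subset.2 hKL)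
  have hsupp : tsupport f ⊆ L := closure_minimal (fun x hx => by
    by_contra h
    exact hx (hf0 fun h' => h (interior_subset h'))) hL.isClosed
  exact ⟨f, f.contMDiff.contDiff, hL.of_isClosed_subset (isClosed_tsupport _) hsupp,
    hsupp.trans hLU, fun x hx => hf1 hx, hf⟩

/-- Finitely many pairwise disjoint compact sets have pairwise disjoint open neighbourhoods. -/
lemma exists_disjoint_open {ι : Type*} (P : Finset ι) (K : ι → Set (Eu m))
    (hK : ∀ p ∈ P, IsCompact (K p)) (hd : (P : Set ι).PairwiseDisjoint K) :
    ∃ V : ι → Set (Eu m), (∀ p, IsOpen (V p)) ∧ (∀ p ∈ P, K p ⊆ V p) ∧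
      (P : Set ι).PairwiseDisjoint V := by
  classical
  let L : ι → Set (Eu m) := fun p => ⋃ q ∈ P.erase p, K q
  -- The neighbourhood of `K p` consists of the points strictly closer to it than to the union of
  -- the other compact sets.
  refine ⟨fun p => {x | Metric.infEDist x (K p) < Metric.infEDist x (L p)}, fun p => ?_,
    fun p hp x hx => ?_, fun p hp q hq hpq => ?_⟩
  · exact isOpen_lt Metric.continuous_infEDist Metric.continuous_infEDist
  · have hL : IsClosed (L p) :=
      (P.erase p).isCompact_biUnion (fun q hq => hK q (Finset.mem_of_mem_erase hq)) |>.isClosed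
    have hxL : x ∉ L p := by
      intro h
      obtain ⟨q, hq, hxq⟩ := mem_iUnion₂.1 h
      exact disjoint_left.1 (hd hp (Finset.mem_of_mem_erase hq) (Finset.ne_of_mem_erase hq).symm)
        hx hxq
    simp only [mem_ofPred_eq, Metric.infEDist_zero_of_mem hx]
    rw [pos_iff_ne_zero]
    intro h
    exact hxL ((Metric.mem_iff_infEDist_zero_of_closed hL).2 h)
  · have hsub : ∀ p ∈ P, ∀ q ∈ P, p ≠ q → K q ⊆ L p := fun p _ q hq hpq =>
      subset_biUnion_of_mem (u := fun q => K q)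
        (show q ∈ (P.erase p : Finset ι) from Finset.mem_erase.2 ⟨hpq.symm, hq⟩)
    refine disjoint_left.2 fun x hx hx' => ?_
    simp only [mem_ofPred_eq] at hx hx'
    have h1 := hx.trans_le (Metric.infEDist_anti (x := x) (hsub p hp q hq hpq))
    have h2 := hx'.trans_le (Metric.infEDist_anti (x := x) (hsub q hq p hp hpq.symm))
    exact lt_asymm h1 h2

/-- A near-optimal finite partition of B is shrunk to disjoint compact pieces. A test field close to
the direction of μ(K_p) on each piece K_p, and cut off smoothly in disjoint neighbourhoods, nearly
attains Σ‖μ(p)‖. -/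
lemma HasGradientMeasure.varOn_le_TV {Ω : Set (Eu m)} {u : Eu m → ℝ} {μ : VectorMeasure Ω (Eu m)}
    (h : HasGradientMeasure Ω u μ) (hu : IntegrableOn u Ω)
    (hΩ : IsOpen Ω) {B : Set (Eu m)} (hB : IsOpen B) (hBΩ : B ⊆ Ω) : varOn μ B ≤ TV B u := by
  have : LocallyCompactSpace Ω := hΩ.locallyCompactSpace
  have hBm : MeasurableSet ((↑) ⁻¹' B : Set Ω) := hB.measurableSet.preimage measurable_subtype_coe
  refine le_of_forall_lt_imp_le_of_dense fun a ha => ?_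
  obtain ⟨P, hPB, hPd, hPm, haP⟩ := VectorMeasure.exists_lt_sum_of_lt_variation μ hBm ha
  refine haP.le.trans ?_
  -- Each piece loses δ twice: once when `p` shrinks to `K p`, once when the indicator of `K p` is
  -- replaced by a smooth cutoff.
  have key : ∀ δ : ℝ, 0 < δ → ENNReal.ofReal (∑ p ∈ P, (‖μ p‖ - 2 * δ)) ≤ TV B u := by
    intro δ hδ
    have hδ' : ENNReal.ofReal δ ≠ 0 := by simpa using hδ
    have hK : ∀ p ∈ P, ∃ K ⊆ p, IsCompact K ∧ μ.variation (p \ K) < ENNReal.ofReal δ :=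
      fun p hp => (hPm p hp).exists_isCompact_sdiff_lt (measure_ne_top _ _) hδ'
    choose! K hKp hKc hKδ using hK
    have hO : ∀ p ∈ P, ∃ O ⊇ K p, IsOpen O ∧ μ.variation O < ⊤ ∧
        μ.variation (O \ K p) < ENNReal.ofReal δ := fun p hp =>
      (hKc p hp).measurableSet.exists_isOpen_sdiff_lt (measure_ne_top _ _) hδ'
    choose! O hKO hOo _ hOδ using hO
    obtain ⟨V, hVo, hKV, hVd⟩ := exists_disjoint_open P (fun p => ((↑) '' K p : Set (Eu m)))
      (fun p hp => (hKc p hp).image continuous_subtype_val) (fun p hp q hq hpq =>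
        (disjoint_image_iff Subtype.val_injective).2
          ((hPd hp hq hpq).mono (hKp p hp) (hKp q hq)))
    have hψ : ∀ p ∈ P, ∃ ψ : Eu m → ℝ, ContDiff ℝ ∞ ψ ∧ HasCompactSupport ψ ∧
        tsupport ψ ⊆ V p ∩ (B ∩ (↑) '' O p) ∧ (∀ x ∈ ((↑) '' K p : Set (Eu m)), ψ x = 1) ∧
        ∀ x, ψ x ∈ Icc (0 : ℝ) 1 := fun p hp =>
      exists_smooth_urysohn ((hKc p hp).image continuous_subtype_val)
        ((hVo p).inter (hB.inter (hΩ.isOpenMap_subtype_val _ (hOo p hp))))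
        (subset_inter (hKV p hp) (subset_inter
          (image_subset_iff.2 ((hKp p hp).trans (hPB p hp))) (image_mono (hKO p hp))))
    choose! ψ hψs hψc hψt hψ1 hψi using hψ
    -- The direction of `μ (K p)`; it is zero when that vector vanishes, since the inverse of zero
    -- is zero.
    let v : Set Ω → Eu m := fun p => ‖μ (K p)‖⁻¹ • μ (K p)
    have hv : ∀ p, ‖v p‖ ≤ 1 := fun p => by
      rw [norm_smul, norm_inv, norm_norm]
      exact inv_mul_le_one
    have hvi : ∀ p, inner ℝ (v p) (μ (K p)) = ‖μ (K p)‖ := fun p => by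
      rw [real_inner_smul_left, real_inner_self_eq_norm_sq]
      rcases eq_or_ne ‖μ (K p)‖ 0 with h0 | h0
      · simp [h0]
      · field_simp
    -- The sign cancels the one in the integration by parts formula.
    let φ : Eu m → Eu m := fun x => ∑ p ∈ P, -(ψ p x • v p)
    have hφ : IsTestField B φ := by
      have hsupp : Function.support φ ⊆ ⋃ p ∈ P, tsupport (ψ p) := by
        intro x hx
        obtain ⟨p, hp, hpx⟩ := Finset.exists_ne_zero_of_sum_ne_zero hx
        refine mem_biUnion hp (subset_tsupport _ ?_)
        intro h0
        simp [h0] at hpx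
      have hcomp : IsCompact (⋃ p ∈ P, tsupport (ψ p)) := P.isCompact_biUnion hψc
      have htsupp : tsupport φ ⊆ ⋃ p ∈ P, tsupport (ψ p) :=
        closure_minimal hsupp hcomp.isClosed
      refine ⟨ContDiff.sum fun p hp => ((hψs p hp).smul contDiff_const).neg,
        hcomp.of_isClosed_subset (isClosed_tsupport _) htsupp,
        htsupp.trans (iUnion₂_subset fun p hp => (hψt p hp).trans fun x hx => hx.2.1),
        fun x => ?_⟩
      by_cases hx : ∃ p ∈ P, x ∈ V p
      · obtain ⟨p, hp, hxp⟩ := hx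
        have : φ x = -(ψ p x • v p) := by
          refine Finset.sum_eq_single_of_mem p hp fun q hq hqp => ?_
          have : ψ q x = 0 := image_eq_zero_of_notMem_tsupport fun h' =>
            disjoint_left.1 (hVd hq hp hqp) (hψt q hq h').1 hxp
          simp [this]
        rw [this, norm_neg, norm_smul, Real.norm_of_nonneg (hψi p hp x).1]
        exact mul_le_one₀ (hψi p hp x).2 (norm_nonneg _) (hv p)
      · have : φ x = 0 := Finset.sum_eq_zero fun p hp => by
          have : ψ p x = 0 := image_eq_zero_of_notMem_tsupport fun h' =>
            hx ⟨p, hp, (hψt p hp h').1⟩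
          simp [this]
        simp [this]
    have hψint : ∀ p ∈ P, Integrable (fun x : Ω => ψ p x) μ.variation := fun p hp =>
      integrable_coe_of_hasCompactSupport _ (hψs p hp).continuous (hψc p hp)
    refine (ENNReal.ofReal_le_ofReal ?_).trans (le_TV u hφ)
    rw [setIntegral_mul_divergence_eq hBΩ hΩ.measurableSet u hφ.tsupport_subset,
      h.integral_mul_divergence hu hφ.contDiff hφ.hasCompactSupport
        (hφ.tsupport_subset.trans hBΩ)]
    simp only [φ]
    rw [VectorMeasure.integral_finsetSum (f := fun p (x : Ω) => -(ψ p x • v p)) P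
        fun p hp => ((hψint p hp).smul_const (v p)).neg,
      ← Finset.sum_neg_distrib]
    refine Finset.sum_le_sum fun p hp => ?_
    rw [VectorMeasure.integral_fun_neg, neg_neg, ← inner_integral_smul μ (hψint p hp)]
    have hKm : MeasurableSet (K p) := (hKc p hp).measurableSet
    have e1 : ‖μ p‖ ≤ ‖μ (K p)‖ + δ := by
      rw [← VectorMeasure.of_add_of_sdiff hKm (hPm p hp) (hKp p hp)]
      refine (norm_add_le _ _).trans (add_le_add_right ?_ _)
      refine (VectorMeasure.norm_measure_le_variation (measure_ne_top _ _)).trans ?_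
      exact ENNReal.toReal_le_of_le_ofReal hδ.le (hKδ p hp).le
    have e2 : ‖(∫ᵛ x : Ω, ψ p x ∂•μ) - μ (K p)‖ ≤ δ := by
      have hone : ∫ᵛ x, (K p).indicator (fun _ => (1 : ℝ)) x ∂•μ = μ (K p) := by
        rw [VectorMeasure.integral_indicator_const _ hKm]
        simp
      have hint1 : Integrable ((K p).indicator (fun _ => (1 : ℝ))) μ.variation :=
        (integrable_const _).indicator hKm
      rw [← hone, ← VectorMeasure.integral_fun_sub (hψint p hp) hint1]
      refine (VectorMeasure.norm_integral_le_integral_norm).trans ?_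
      have hOK : MeasurableSet (O p \ K p) := (hOo p hp).measurableSet.diff hKm
      have hind : ∫ x, (O p \ K p).indicator (fun _ => (1 : ℝ)) x ∂μ.variation ≤ δ := by
        rw [integral_indicator hOK]
        simp only [integral_const, smul_eq_mul, mul_one]
        rw [Measure.real, Measure.restrict_apply_univ]
        exact ENNReal.toReal_le_of_le_ofReal hδ.le (hOδ p hp).le
      refine le_trans ?_ hind
      have hB1 : ‖(ContinuousLinearMap.lsmul ℝ ℝ : ℝ →L[ℝ] Eu m →L[ℝ] Eu m)‖ ≤ 1 :=
        ContinuousLinearMap.opNorm_lsmul_le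
      refine (mul_le_of_le_one_left (integral_nonneg fun _ => norm_nonneg _) hB1).trans ?_
      refine integral_mono ((hψint p hp).sub hint1).norm ((integrable_const _).indicator hOK)
        fun x => ?_
      by_cases hxK : x ∈ K p
      · simp [hxK, hψ1 p hp x (mem_image_of_mem _ hxK)]
      · by_cases hxO : x ∈ O p
        · have := hψi p hp x
          rw [indicator_of_notMem hxK, sub_zero, Real.norm_of_nonneg this.1,
            indicator_of_mem (show x ∈ O p \ K p from ⟨hxO, hxK⟩)]
          exact this.2
        · have : ψ p x = 0 := image_eq_zero_of_notMem_tsupport fun h' => by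
            obtain ⟨y, hy, hyx⟩ := (hψt p hp h').2.2
            exact hxO (Subtype.val_injective hyx ▸ hy)
          simp [hxK, hxO, this]
    have e3 : inner ℝ (v p) (∫ᵛ x : Ω, ψ p x ∂•μ)
        = ‖μ (K p)‖ + inner ℝ (v p) ((∫ᵛ x : Ω, ψ p x ∂•μ) - μ (K p)) := by
      rw [inner_sub_right, hvi]
      ring
    have e4 : |inner ℝ (v p) ((∫ᵛ x : Ω, ψ p x ∂•μ) - μ (K p))| ≤ δ :=
      (abs_real_inner_le_norm _ _).trans
        ((mul_le_of_le_one_left (norm_nonneg _) (hv p)).trans e2)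
    rw [e3]
    linarith [neg_le_of_abs_le e4]
  have hlim : Tendsto (fun δ : ℝ => ENNReal.ofReal (∑ p ∈ P, (‖μ p‖ - 2 * δ))) (𝓝[>] 0)
      (𝓝 (ENNReal.ofReal (∑ p ∈ P, (‖μ p‖ - 2 * 0)))) := by
    refine tendsto_nhdsWithin_of_tendsto_nhds ?_
    exact (ENNReal.continuous_ofReal.comp (by fun_prop)).tendsto 0
  have h0 : ∑ p ∈ P, ‖μ p‖ₑ = ENNReal.ofReal (∑ p ∈ P, (‖μ p‖ - 2 * 0)) := by
    simp only [mul_zero, sub_zero]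
    rw [ENNReal.ofReal_sum_of_nonneg fun _ _ => norm_nonneg _]
    simp
  rw [h0]
  refine le_of_tendsto hlim ?_
  filter_upwards [self_mem_nhdsWithin] with δ hδ using key δ hδ

/-- On open sets, the total variation measure of the gradient is the total variation. -/
theorem HasGradientMeasure.varOn_eq_TV {Ω : Set (Eu m)} {u : Eu m → ℝ}
    {μ : VectorMeasure Ω (Eu m)}
    (h : HasGradientMeasure Ω u μ) (hu : IntegrableOn u Ω)
    (hΩ : IsOpen Ω) {B : Set (Eu m)} (hB : IsOpen B) (hBΩ : B ⊆ Ω) : varOn μ B = TV B u :=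
  le_antisymm (h.varOn_le_TV hu hΩ hB hBΩ) (h.TV_le hu hΩ hB hBΩ)

/-! ### Lipschitz transformations -/

lemma jacobian_eq_abs_det (γ : PartialEquiv (Eu m) (Eu m)) (x : Eu m) :
    jacobian γ x = |(fderiv ℝ γ x).det| := by
  have h := ContinuousLinearMap.normDet_sq (𝕜 := ℝ) (fderiv ℝ γ x)
  have h1 : (fderiv ℝ γ x : Eu m →ₗ[ℝ] Eu m).normDet = |(fderiv ℝ γ x).det| :=
    LinearMap.normDet_eq_abs_det _
  have h2 : (ContinuousLinearMap.adjoint (fderiv ℝ γ x) ∘L fderiv ℝ γ x).det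
      = |(fderiv ℝ γ x).det| ^ 2 := by
    rw [← h1]
    exact h.symm
  rw [jacobian, h2, Real.sqrt_sq (abs_nonneg _)]

lemma jacobian_nonneg (γ : PartialEquiv (Eu m) (Eu m)) (x : Eu m) : 0 ≤ jacobian γ x :=
  Real.sqrt_nonneg _

lemma continuous_clm_det : Continuous (fun L : Eu m →L[ℝ] Eu m => L.det) :=
  ContinuousLinearMap.continuous_det

lemma measurable_jacobian (γ : PartialEquiv (Eu m) (Eu m)) : Measurable (jacobian γ) := by
  have h : jacobian γ = fun x => |(fderiv ℝ γ x).det| := funext (jacobian_eq_abs_det γ)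
  rw [h]
  exact (continuous_clm_det.abs.measurable).comp (measurable_fderiv ℝ γ)

lemma adjoint_lipJac (γ : PartialEquiv (Eu m) (Eu m)) (x : Eu m) :
    ContinuousLinearMap.adjoint (lipJac γ x) = jacobian γ x • fderiv ℝ γ.symm (γ x) := by
  simp [lipJac, invGrad]

namespace IsLipTransform

variable {Ω U : Set (Eu m)} {γ : PartialEquiv (Eu m) (Eu m)}

lemma symm (hγ : IsLipTransform Ω U γ) : IsLipTransform Ω U γ.symm where
  source_eq := hγ.target_eq
  target_eq := hγ.source_eq
  lipschitz := hγ.lipschitz_symm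
  lipschitz_symm := by simpa using hγ.lipschitz
  lusin := hγ.lusin_symm
  lusin_symm := by simpa using hγ.lusin
  eq_self x hx := by
    have h := γ.left_inv (hγ.source_eq ▸ hx.1)
    rwa [hγ.eq_self x hx] at h

variable (hγ : IsLipTransform Ω U γ)

include hγ

lemma mapsTo : MapsTo γ Ω Ω := fun x hx => by
  have h := γ.map_source (hγ.source_eq ▸ hx)
  rwa [hγ.target_eq] at h

lemma left_inv {x : Eu m} (hx : x ∈ Ω) : γ.symm (γ x) = x := γ.left_inv (hγ.source_eq ▸ hx)

lemma right_inv {x : Eu m} (hx : x ∈ Ω) : γ (γ.symm x) = x := γ.right_inv (hγ.target_eq ▸ hx)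

lemma injOn : InjOn γ Ω := fun x hx y hy h => by
  rw [← hγ.left_inv hx, h, hγ.left_inv hy]

lemma continuousOn : ContinuousOn γ Ω := hγ.lipschitz.choose_spec.continuousOn

lemma image_eq {A : Set (Eu m)} (hA : A ⊆ Ω) : γ '' A = Ω ∩ γ.symm ⁻¹' A := by
  ext y
  constructor
  · rintro ⟨x, hx, rfl⟩
    refine ⟨hγ.mapsTo (hA hx), ?_⟩
    rwa [mem_preimage, hγ.left_inv (hA hx)]
  · rintro ⟨hy, hy'⟩
    exact ⟨_, hy', hγ.right_inv hy⟩

lemma image_subset {A : Set (Eu m)} (hA : A ⊆ Ω) : γ '' A ⊆ Ω :=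
  (image_mono hA).trans hγ.mapsTo.image_subset

lemma image_univ : γ '' Ω = Ω := by
  rw [hγ.image_eq Subset.rfl]
  exact inter_eq_left.2 hγ.symm.mapsTo

lemma isOpen_image (hΩ : IsOpen Ω) {A : Set (Eu m)} (hAo : IsOpen A) (hA : A ⊆ Ω) :
    IsOpen (γ '' A) := by
  rw [hγ.image_eq hA]
  exact hγ.symm.continuousOn.isOpen_inter_preimage hΩ hAo

lemma ae_differentiableAt (hΩ : IsOpen Ω) :
    ∀ᵐ x ∂volume.restrict Ω, DifferentiableAt ℝ γ x := by
  obtain ⟨K, hK⟩ := hγ.lipschitz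
  filter_upwards [hK.ae_differentiableWithinAt (μ := volume) hΩ.measurableSet,
    ae_restrict_mem hΩ.measurableSet] with x hx hxΩ
  exact hx.differentiableAt (hΩ.mem_nhds hxΩ)

lemma exists_norm_fderiv_le (hΩ : IsOpen Ω) : ∃ C : ℝ, 0 ≤ C ∧ ∀ x ∈ Ω, ‖fderiv ℝ γ x‖ ≤ C := by
  obtain ⟨K, hK⟩ := hγ.lipschitz
  exact ⟨K, K.2, fun x hx => norm_fderiv_le_of_lipschitzOn ℝ (hΩ.mem_nhds hx) hK⟩

lemma exists_jacobian_le (hΩ : IsOpen Ω) : ∃ C : ℝ, 0 ≤ C ∧ ∀ x ∈ Ω, jacobian γ x ≤ C := by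
  obtain ⟨C, -, hC⟩ := hγ.exists_norm_fderiv_le hΩ
  obtain ⟨D, hD⟩ := (isCompact_closedBall (0 : Eu m →L[ℝ] Eu m) C).exists_bound_of_continuousOn
    continuous_clm_det.continuousOn
  refine ⟨max D 0, le_max_right _ _, fun x hx => ?_⟩
  rw [jacobian_eq_abs_det]
  exact (hD _ (by simpa using hC x hx)).trans (le_max_left _ _)

lemma exists_norm_invGrad_le (hΩ : IsOpen Ω) : ∃ C : ℝ, 0 ≤ C ∧ ∀ x ∈ Ω, ‖invGrad γ x‖ ≤ C := by
  obtain ⟨C, hC0, hC⟩ := hγ.symm.exists_norm_fderiv_le hΩ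
  refine ⟨C, hC0, fun x hx => ?_⟩
  rw [invGrad, LinearIsometryEquiv.norm_map]
  exact hC _ (hγ.mapsTo hx)

lemma exists_norm_lipJac_le (hΩ : IsOpen Ω) : ∃ C : ℝ, 0 ≤ C ∧ ∀ x ∈ Ω, ‖lipJac γ x‖ ≤ C := by
  obtain ⟨C, hC0, hC⟩ := hγ.exists_norm_invGrad_le hΩ
  obtain ⟨D, hD0, hD⟩ := hγ.exists_jacobian_le hΩ
  refine ⟨D * C, by positivity, fun x hx => ?_⟩
  rw [lipJac, norm_smul, Real.norm_of_nonneg (jacobian_nonneg γ x)]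
  exact mul_le_mul (hD x hx) (hC x hx) (norm_nonneg _) hD0

lemma aemeasurable (hΩ : IsOpen Ω) : AEMeasurable γ (volume.restrict Ω) :=
  hγ.continuousOn.aemeasurable hΩ.measurableSet

/-- The exceptional points form the image under γ⁻¹ of a null set, which is null by the Lusin
property of γ⁻¹. -/
lemma ae_comp (hΩ : IsOpen Ω) {P : Eu m → Prop} (h : ∀ᵐ y ∂volume.restrict Ω, P y) :
    ∀ᵐ x ∂volume.restrict Ω, P (γ x) := by
  rw [ae_restrict_iff' hΩ.measurableSet, ae_iff] at h ⊢
  have h0 : volume (γ.symm '' {a | ¬(a ∈ Ω → P a)}) = 0 :=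
    hγ.lusin_symm _ (fun a ha => by
      by_contra h'
      exact ha fun h'' => absurd h'' h') h
  refine measure_mono_null (fun x hx => ?_) h0
  simp only [mem_ofPred_eq, Classical.not_imp] at hx
  exact ⟨γ x, fun h' => hx.2 (h' (hγ.mapsTo hx.1)), hγ.left_inv hx.1⟩

/-- The full-measure subset on which the change of variables formula applies. -/
lemma exists_regular_set (hΩ : IsOpen Ω) : ∃ s ⊆ Ω, MeasurableSet s ∧
    (∀ x ∈ s, HasFDerivWithinAt γ (fderiv ℝ γ x) s x) ∧
    s =ᵐ[volume] Ω ∧ γ '' s =ᵐ[volume] Ω := by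
  refine ⟨Ω ∩ {x | DifferentiableAt ℝ γ x}, inter_subset_left,
    hΩ.measurableSet.inter (measurableSet_of_differentiableAt ℝ γ), fun x hx =>
      (DifferentiableAt.hasFDerivAt hx.2).hasFDerivWithinAt, ?_, ?_⟩
  · have h := hγ.ae_differentiableAt hΩ
    rw [ae_restrict_iff' hΩ.measurableSet] at h
    filter_upwards [h] with x hx
    exact propext ⟨fun h => h.1, fun h => ⟨h, hx h⟩⟩
  · have h := hγ.symm.ae_comp hΩ (hγ.ae_differentiableAt hΩ)
    rw [ae_restrict_iff' hΩ.measurableSet] at h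
    rw [hγ.image_eq inter_subset_left]
    filter_upwards [h] with x hx
    exact propext ⟨fun h => h.1, fun h => ⟨h, hγ.symm.mapsTo h, hx h⟩⟩

/-- Change of variables along a Lipschitz transformation. -/
lemma integral_comp (hΩ : IsOpen Ω) (F : Eu m → ℝ) :
    ∫ y in Ω, F y = ∫ x in Ω, jacobian γ x * F (γ x) := by
  obtain ⟨s, hsΩ, hs, hd, hs1, hs2⟩ := hγ.exists_regular_set hΩ
  rw [← setIntegral_congr_set hs2, ← setIntegral_congr_set hs1,
    integral_image_eq_integral_abs_det_fderiv_smul volume hs hd (hγ.injOn.mono hsΩ)]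
  simp only [jacobian_eq_abs_det, smul_eq_mul]

lemma integrableOn_pushforward (hΩ : IsOpen Ω) {u : Eu m → ℝ} (hu : IntegrableOn u Ω) :
    IntegrableOn (pushforward γ u) Ω := by
  obtain ⟨s, hsΩ, hs, hd, hs1, hs2⟩ := hγ.exists_regular_set hΩ
  obtain ⟨C, -, hC⟩ := hγ.exists_jacobian_le hΩ
  rw [← integrableOn_congr_set_ae hs2,
    integrableOn_image_iff_integrableOn_abs_det_fderiv_smul volume hs hd (hγ.injOn.mono hsΩ)]
  have h : IntegrableOn (fun x => jacobian γ x * u x) s := by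
    refine (hu.mono_set hsΩ).bdd_mul (c := C) (measurable_jacobian γ).aestronglyMeasurable ?_
    filter_upwards [ae_restrict_mem hs] with x hx
    rw [Real.norm_of_nonneg (jacobian_nonneg γ x)]
    exact hC x (hsΩ hx)
  refine h.congr_fun (fun x hx => ?_) hs
  simp [pushforward, hγ.left_inv (hsΩ hx), jacobian_eq_abs_det]

lemma aestronglyMeasurable_lipJac (hΩ : IsOpen Ω) :
    AEStronglyMeasurable (lipJac γ) (volume.restrict Ω) := by
  have h1 : AEMeasurable (fun x => fderiv ℝ γ.symm (γ x)) (volume.restrict Ω) :=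
    (measurable_fderiv ℝ γ.symm).comp_aemeasurable (hγ.aemeasurable hΩ)
  exact (measurable_jacobian γ).aestronglyMeasurable.smul
    (ContinuousLinearMap.adjoint.continuous.comp_aestronglyMeasurable h1.aestronglyMeasurable)

end IsLipTransform

/-! ### Pulling back vector fields -/

/-- The pull-back of a vector field, `L_γ(x)* φ(γ(x))` on `Ω`. -/
def pullField (Ω : Set (Eu m)) (γ : PartialEquiv (Eu m) (Eu m)) (φ : Eu m → Eu m) :
    Eu m → Eu m :=
  Ω.indicator fun x => ContinuousLinearMap.adjoint (lipJac γ x) (φ (γ x))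

/-- The pull-back of the divergence of a vector field, `J γ(x) (div φ)(γ(x))` on `Ω`. -/
def pullDiv (Ω : Set (Eu m)) (γ : PartialEquiv (Eu m) (Eu m)) (φ : Eu m → Eu m) : Eu m → ℝ :=
  Ω.indicator fun x => jacobian γ x * divergence φ (γ x)

namespace IsLipTransform

variable {Ω U : Set (Eu m)} {γ : PartialEquiv (Eu m) (Eu m)} {φ : Eu m → Eu m}
  (hγ : IsLipTransform Ω U γ)

include hγ

lemma isCompact_preimage (hc : HasCompactSupport φ) (hs : tsupport φ ⊆ Ω) :
    IsCompact (γ.symm '' tsupport φ) :=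
  IsCompact.image_of_continuousOn hc (hγ.symm.continuousOn.mono hs)

lemma notMem_of_notMem_preimage {x : Eu m} (hx : x ∈ Ω) (h : x ∉ γ.symm '' tsupport φ) :
    γ x ∉ tsupport φ := fun h' => h ⟨γ x, h', hγ.left_inv hx⟩

lemma pullField_eq_zero {x : Eu m} (h : x ∉ γ.symm '' tsupport φ) : pullField Ω γ φ x = 0 := by
  by_cases hx : x ∈ Ω
  · rw [pullField, indicator_of_mem hx,
      image_eq_zero_of_notMem_tsupport (hγ.notMem_of_notMem_preimage hx h), map_zero]
  · exact indicator_of_notMem hx _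

lemma pullDiv_eq_zero {x : Eu m} (h : x ∉ γ.symm '' tsupport φ) : pullDiv Ω γ φ x = 0 := by
  by_cases hx : x ∈ Ω
  · rw [pullDiv, indicator_of_mem hx,
      divergence_eq_zero (hγ.notMem_of_notMem_preimage hx h), mul_zero]
  · exact indicator_of_notMem hx _

lemma exists_pullDiv_le (hΩ : IsOpen Ω) (hφ : ContDiff ℝ ∞ φ) (hc : HasCompactSupport φ) :
    ∃ M, ∀ x, ‖pullDiv Ω γ φ x‖ ≤ M := by
  obtain ⟨C, hC0, hC⟩ := hγ.exists_jacobian_le hΩ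
  obtain ⟨D, hD⟩ := exists_bound_divergence hφ hc
  have hD0 : 0 ≤ D := (norm_nonneg _).trans (hD 0)
  refine ⟨C * D, fun x => ?_⟩
  by_cases hx : x ∈ Ω
  · rw [pullDiv, indicator_of_mem hx, norm_mul, Real.norm_of_nonneg (jacobian_nonneg γ x)]
    exact mul_le_mul (hC x hx) (hD _) (norm_nonneg _) hC0
  · rw [pullDiv, indicator_of_notMem hx, norm_zero]
    positivity

lemma locallyIntegrable_pullDiv (hΩ : IsOpen Ω) (hφ : ContDiff ℝ ∞ φ)
    (hc : HasCompactSupport φ) : LocallyIntegrable (pullDiv Ω γ φ) := by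
  obtain ⟨M, hM⟩ := hγ.exists_pullDiv_le hΩ hφ hc
  refine (locallyIntegrable_const M).mono ?_ (Eventually.of_forall fun x =>
    (hM x).trans (le_abs_self _))
  refine (aestronglyMeasurable_indicator_iff hΩ.measurableSet).2 ?_
  exact (measurable_jacobian γ).aestronglyMeasurable.mul
    ((continuous_divergence hφ).measurable.comp_aemeasurable
      (hγ.aemeasurable hΩ)).aestronglyMeasurable

lemma exists_pullField_le (hΩ : IsOpen Ω) :
    ∃ C : ℝ, 0 ≤ C ∧ ∀ (φ : Eu m → Eu m) (x : Eu m),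
      ‖pullField Ω γ φ x‖ ≤ C * Ω.indicator (fun x => ‖φ (γ x)‖) x := by
  obtain ⟨C, hC0, hC⟩ := hγ.exists_norm_lipJac_le hΩ
  refine ⟨C, hC0, fun φ x => ?_⟩
  by_cases hx : x ∈ Ω
  · rw [pullField, indicator_of_mem hx, indicator_of_mem hx]
    refine (ContinuousLinearMap.le_opNorm _ _).trans ?_
    rw [LinearIsometryEquiv.norm_map]
    exact mul_le_mul_of_nonneg_right (hC x hx) (norm_nonneg _)
  · simp [pullField, hx]

lemma locallyIntegrable_pullField (hΩ : IsOpen Ω) (hφ : ContDiff ℝ ∞ φ)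
    (hc : HasCompactSupport φ) : LocallyIntegrable (pullField Ω γ φ) := by
  obtain ⟨C, hC0, hC⟩ := hγ.exists_pullField_le hΩ
  obtain ⟨D, hD⟩ := hc.exists_bound_of_continuous hφ.continuous
  have hD0 : 0 ≤ D := (norm_nonneg _).trans (hD 0)
  refine (locallyIntegrable_const (C * D)).mono ?_ (Eventually.of_forall fun x => ?_)
  · refine (aestronglyMeasurable_indicator_iff hΩ.measurableSet).2 ?_
    have h1 : AEStronglyMeasurable (fun x => ContinuousLinearMap.adjoint (lipJac γ x))
        (volume.restrict Ω) :=
      ContinuousLinearMap.adjoint.continuous.comp_aestronglyMeasurable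
        (hγ.aestronglyMeasurable_lipJac hΩ)
    exact (ContinuousLinearMap.id ℝ (Eu m →L[ℝ] Eu m)).aestronglyMeasurable_comp₂ h1
      (hφ.continuous.measurable.comp_aemeasurable
      (hγ.aemeasurable hΩ)).aestronglyMeasurable
  · refine (hC φ x).trans (le_trans ?_ (le_abs_self _))
    refine mul_le_mul_of_nonneg_left ?_ hC0
    exact indicator_le' (fun x _ => hD _) (fun _ _ => hD0) x

lemma integral_pushforward_mul_divergence (hΩ : IsOpen Ω) (u : Eu m → ℝ) (φ : Eu m → Eu m) :
    ∫ y in Ω, pushforward γ u y * divergence φ y = ∫ x in Ω, u x * pullDiv Ω γ φ x := by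
  rw [hγ.integral_comp hΩ]
  refine setIntegral_congr_fun hΩ.measurableSet fun x hx => ?_
  simp only [pushforward, Function.comp_apply, hγ.left_inv hx, pullDiv, indicator_of_mem hx]
  ring

/-- The Piola identity: the pull-back of a vector field has the pull-back of the divergence as its
distributional divergence. -/
lemma hasWeakDiv_pull (hΩ : IsOpen Ω) (hφ : ContDiff ℝ ∞ φ)
    (hc : HasCompactSupport φ) (hs : tsupport φ ⊆ Ω) :
    HasWeakDiv (pullField Ω γ φ) (pullDiv Ω γ φ) := by
  intro ψ hψ hψc
  obtain ⟨K, hK⟩ := exists_lipschitzWith hψ hψc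
  obtain ⟨L, hL⟩ := hγ.lipschitz_symm
  -- ψ ∘ γ⁻¹ is Lipschitz only on Ω, so a Lipschitz extension to ℝ^m is integrated by parts instead.
  -- Its values off Ω are irrelevant, because φ is supported in Ω.
  obtain ⟨g, hg, hge⟩ := (hK.comp_lipschitzOnWith hL).extend_real
  have h1 : ∫ x, ψ x * pullDiv Ω γ φ x = ∫ x in Ω, ψ x * pullDiv Ω γ φ x := by
    rw [setIntegral_eq_integral_of_forall_compl_eq_zero]
    intro x hx
    rw [pullDiv, indicator_of_notMem hx, mul_zero]
  have h2 : ∫ y in Ω, pushforward γ ψ y * divergence φ y = ∫ y in Ω, g y * divergence φ y :=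
    setIntegral_congr_fun hΩ.measurableSet fun y hy => by
      simp only [pushforward]
      rw [hge hy]
  have h3 : ∫ y in Ω, g y * divergence φ y = ∫ y, g y * divergence φ y := by
    rw [setIntegral_eq_integral_of_forall_compl_eq_zero]
    intro x hx
    rw [divergence_eq_zero fun h => hx (hs h), mul_zero]
  have h4 : ∫ y, fderiv ℝ g y (φ y) = ∫ y in Ω, fderiv ℝ g y (φ y) := by
    rw [setIntegral_eq_integral_of_forall_compl_eq_zero]
    intro x hx
    rw [image_eq_zero_of_notMem_tsupport fun h => hx (hs h), map_zero]
  have h5 : ∫ x, fderiv ℝ ψ x (pullField Ω γ φ x)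
      = ∫ x in Ω, fderiv ℝ ψ x (pullField Ω γ φ x) := by
    rw [setIntegral_eq_integral_of_forall_compl_eq_zero]
    intro x hx
    rw [pullField, indicator_of_notMem hx, map_zero]
  rw [h1, ← hγ.integral_pushforward_mul_divergence hΩ, h2, h3,
    integral_lipschitz_mul_divergence hg hφ hc, h4, hγ.integral_comp hΩ, h5]
  congr 1
  refine integral_congr_ae ?_
  filter_upwards [hγ.ae_comp hΩ (hγ.symm.ae_differentiableAt hΩ),
    ae_restrict_mem hΩ.measurableSet] with x hx hxΩ
  have hd : HasFDerivAt g ((fderiv ℝ ψ x).comp (fderiv ℝ γ.symm (γ x))) (γ x) := by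
    have h6 : HasFDerivAt ψ (fderiv ℝ ψ x) (γ.symm (γ x)) := by
      rw [hγ.left_inv hxΩ]
      exact (hψ.differentiable (by simp) x).hasFDerivAt
    refine (h6.comp (γ x) hx.hasFDerivAt).congr_of_eventuallyEq ?_
    filter_upwards [hΩ.mem_nhds (hγ.mapsTo hxΩ)] with y hy
    exact (hge hy).symm
  rw [hd.fderiv, pullField, indicator_of_mem hxΩ, adjoint_lipJac]
  simp

end IsLipTransform

/-! ### The comparison of total variations under two transformations -/

section

variable {Ω U₁ U₂ : Set (Eu m)} {γ₁ γ₂ : PartialEquiv (Eu m) (Eu m)}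

/-- One null set serves all v: the supremum over the unit sphere sits inside the essential supremum,
and homogeneity does the rest. A real essential supremum is an a.e. bound only for functions bounded
above; the Lipschitz constants provide this. -/
lemma ae_norm_lipJac_add_le (hΩ : IsOpen Ω) (h₁ : IsLipTransform Ω U₁ γ₁)
    (h₂ : IsLipTransform Ω U₂ γ₂) :
    ∀ᵐ x ∂volume.restrict Ω, ∀ v : Eu m,
      ‖lipJac γ₁ x v‖ + ‖lipJac γ₂ x v‖ ≤ (2 + biG Ω γ₁ γ₂) * ‖v‖ := by
  obtain ⟨C₁, hC₁, hL₁⟩ := h₁.exists_norm_lipJac_le hΩ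
  obtain ⟨C₂, hC₂, hL₂⟩ := h₂.exists_norm_lipJac_le hΩ
  have hb : ∀ x ∈ Ω, ∀ v : Metric.sphere (0 : Eu m) 1,
      ‖lipJac γ₁ x v‖ + ‖lipJac γ₂ x v‖ - 2 * ‖(v : Eu m)‖ ≤ C₁ + C₂ := by
    intro x hx v
    have hv : ‖(v : Eu m)‖ = 1 := by simp
    have e₁ := (lipJac γ₁ x).le_opNorm v
    have e₂ := (lipJac γ₂ x).le_opNorm v
    rw [hv, mul_one] at e₁ e₂
    rw [hv]
    linarith [hL₁ x hx, hL₂ x hx]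
  have hbdd : IsBoundedUnder (· ≤ ·) (ae (volume.restrict Ω)) (fun x =>
      ⨆ v : Metric.sphere (0 : Eu m) 1,
        (‖lipJac γ₁ x v‖ + ‖lipJac γ₂ x v‖ - 2 * ‖(v : Eu m)‖)) := by
    refine ⟨C₁ + C₂, ?_⟩
    rw [eventually_map]
    filter_upwards [ae_restrict_mem hΩ.measurableSet] with x hx
    exact Real.iSup_le (hb x hx) (by positivity)
  filter_upwards [ae_le_essSup hbdd, ae_restrict_mem hΩ.measurableSet] with x hx hxΩ v
  rcases eq_or_ne v 0 with rfl | hv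
  · simp
  have hv' : 0 < ‖v‖ := norm_pos_iff.2 hv
  have hmem : ‖v‖⁻¹ • v ∈ Metric.sphere (0 : Eu m) 1 := by
    rw [mem_sphere_zero_iff_norm, norm_smul, norm_inv, norm_norm, inv_mul_cancel₀ hv'.ne']
  have h1 := (le_ciSup (f := fun v : Metric.sphere (0 : Eu m) 1 =>
    ‖lipJac γ₁ x v‖ + ‖lipJac γ₂ x v‖ - 2 * ‖(v : Eu m)‖)
    ⟨_, forall_mem_range.2 (hb x hxΩ)⟩ ⟨_, hmem⟩).trans hx
  simp only [map_smul, norm_smul, norm_inv, norm_norm, inv_mul_cancel₀ hv'.ne'] at h1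
  have h2 : ‖v‖⁻¹ * (‖lipJac γ₁ x v‖ + ‖lipJac γ₂ x v‖) ≤ 2 + biG Ω γ₁ γ₂ := by
    change _ ≤ biG Ω γ₁ γ₂ at h1
    linarith
  rwa [inv_mul_le_iff₀ hv', mul_comm] at h2

/-- Moving the adjoints across, ⟨w, v⟩ ≤ ‖L₁v‖ + ‖L₂v‖ for the summed field w; the choice v = w
gives the norm bound. The maximum with 0 covers w = 0, in particular points off Ω. -/
lemma ae_norm_pullField_add_le (hΩ : IsOpen Ω) (h₁ : IsLipTransform Ω U₁ γ₁)
    (h₂ : IsLipTransform Ω U₂ γ₂) {φ₁ φ₂ : Eu m → Eu m} (hφ₁ : ∀ x, ‖φ₁ x‖ ≤ 1)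
    (hφ₂ : ∀ x, ‖φ₂ x‖ ≤ 1) :
    ∀ᵐ x, ‖pullField Ω γ₁ φ₁ x + pullField Ω γ₂ φ₂ x‖ ≤ max (2 + biG Ω γ₁ γ₂) 0 := by
  have h := ae_norm_lipJac_add_le hΩ h₁ h₂
  rw [ae_restrict_iff' hΩ.measurableSet] at h
  filter_upwards [h] with x hx
  by_cases hxΩ : x ∈ Ω
  · set w := pullField Ω γ₁ φ₁ x + pullField Ω γ₂ φ₂ x with hw
    have e : ∀ v : Eu m, inner ℝ w v ≤ (2 + biG Ω γ₁ γ₂) * ‖v‖ := by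
      intro v
      refine le_trans ?_ (hx hxΩ v)
      rw [hw, pullField, pullField, indicator_of_mem hxΩ, indicator_of_mem hxΩ, inner_add_left,
        ContinuousLinearMap.adjoint_inner_left, ContinuousLinearMap.adjoint_inner_left]
      refine add_le_add ?_ ?_
      · exact (real_inner_le_norm _ _).trans (mul_le_of_le_one_left (norm_nonneg _) (hφ₁ _))
      · exact (real_inner_le_norm _ _).trans (mul_le_of_le_one_left (norm_nonneg _) (hφ₂ _))
    have e' := e w
    rw [real_inner_self_eq_norm_sq, sq] at e'
    rcases (norm_nonneg w).eq_or_lt with h0 | h0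
    · rw [← h0]
      exact le_max_right _ _
    · exact (le_of_mul_le_mul_right e' h0).trans (le_max_left _ _)
  · simp [pullField, hxΩ]

/-- The total variations of the two push-forwards are jointly controlled by the total variation of
the original function, locally. -/
theorem TV_image_add_le (hΩ : IsOpen Ω) (h₁ : IsLipTransform Ω U₁ γ₁)
    (h₂ : IsLipTransform Ω U₂ γ₂) {u : Eu m → ℝ} (hu : IntegrableOn u Ω) {A : Set (Eu m)}
    (hA : IsOpen A) (hAΩ : A ⊆ Ω) :
    TV (γ₁ '' A) (pushforward γ₁ u) + TV (γ₂ '' A) (pushforward γ₂ u)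
      ≤ ENNReal.ofReal (2 + biG Ω γ₁ γ₂) * TV A u := by
  have key : ∀ φ₁, IsTestField (γ₁ '' A) φ₁ → ∀ φ₂, IsTestField (γ₂ '' A) φ₂ →
      ENNReal.ofReal ((∫ x in γ₁ '' A, pushforward γ₁ u x * divergence φ₁ x)
        + ∫ x in γ₂ '' A, pushforward γ₂ u x * divergence φ₂ x)
      ≤ ENNReal.ofReal (2 + biG Ω γ₁ γ₂) * TV A u := by
    intro φ₁ hφ₁ φ₂ hφ₂
    have hs₁ := hφ₁.tsupport_subset.trans (h₁.image_subset hAΩ)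
    have hs₂ := hφ₂.tsupport_subset.trans (h₂.image_subset hAΩ)
    have hK₁ : γ₁.symm '' tsupport φ₁ ⊆ A := by
      rintro _ ⟨y, hy, rfl⟩
      obtain ⟨x, hx, rfl⟩ := hφ₁.tsupport_subset hy
      rwa [h₁.left_inv (hAΩ hx)]
    have hK₂ : γ₂.symm '' tsupport φ₂ ⊆ A := by
      rintro _ ⟨y, hy, rfl⟩
      obtain ⟨x, hx, rfl⟩ := hφ₂.tsupport_subset hy
      rwa [h₂.left_inv (hAΩ hx)]
    have hKc₁ := h₁.isCompact_preimage hφ₁.hasCompactSupport hs₁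
    have hKc₂ := h₂.isCompact_preimage hφ₂.hasCompactSupport hs₂
    obtain ⟨M₁, hM₁⟩ := h₁.exists_pullDiv_le hΩ hφ₁.contDiff hφ₁.hasCompactSupport
    obtain ⟨M₂, hM₂⟩ := h₂.exists_pullDiv_le hΩ hφ₂.contDiff hφ₂.hasCompactSupport
    have l₁ := h₁.locallyIntegrable_pullDiv hΩ hφ₁.contDiff hφ₁.hasCompactSupport
    have l₂ := h₂.locallyIntegrable_pullDiv hΩ hφ₂.contDiff hφ₂.hasCompactSupport
    have f₁ := h₁.locallyIntegrable_pullField hΩ hφ₁.contDiff hφ₁.hasCompactSupport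
    have f₂ := h₂.locallyIntegrable_pullField hΩ hφ₂.contDiff hφ₂.hasCompactSupport
    have w₁ := h₁.hasWeakDiv_pull hΩ hφ₁.contDiff hφ₁.hasCompactSupport hs₁
    have w₂ := h₂.hasWeakDiv_pull hΩ hφ₂.contDiff hφ₂.hasCompactSupport hs₂
    -- The two pull-backs are merged into a single competitor for u, so that only the joint bound 2
    -- + `biG` enters.
    have hw : HasWeakDiv (fun x => pullField Ω γ₁ φ₁ x + pullField Ω γ₂ φ₂ x)
        (fun x => pullDiv Ω γ₁ φ₁ x + pullDiv Ω γ₂ φ₂ x) := by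
      intro ψ hψ hψc
      have i₁ := l₁.integrable_smul_left_of_hasCompactSupport hψ.continuous hψc
      have i₂ := l₂.integrable_smul_left_of_hasCompactSupport hψ.continuous hψc
      have j : ∀ {Φ : Eu m → Eu m}, LocallyIntegrable Φ →
          Integrable (fun x => fderiv ℝ ψ x (Φ x)) := by
        intro Φ hΦ
        have hn : LocallyIntegrable (fun x => ‖Φ x‖) :=
          hΦ.mono hΦ.aestronglyMeasurable.norm (Eventually.of_forall fun x => by simp)
        have hI := hn.integrable_smul_left_of_hasCompactSupport
          (hψ.continuous_fderiv (by simp)).norm (hψc.fderiv ℝ).norm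
        refine hI.mono ?_ (Eventually.of_forall fun x => ?_)
        · exact (ContinuousLinearMap.id ℝ (Eu m →L[ℝ] ℝ)).aestronglyMeasurable_comp₂
            (hψ.continuous_fderiv (by simp)).aestronglyMeasurable hΦ.aestronglyMeasurable
        · refine (ContinuousLinearMap.le_opNorm _ _).trans ?_
          simp
      simp only [smul_eq_mul] at i₁ i₂
      simp only [mul_add, map_add]
      rw [integral_add i₁ i₂, integral_add (j f₁) (j f₂), w₁ ψ hψ hψc, w₂ ψ hψ hψc, neg_add]
    have hmain := hw.ofReal_integral_le hA (hKc₁.union hKc₂) (union_subset hK₁ hK₂)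
      (fun x hx => by
        rw [h₁.pullField_eq_zero fun h => hx (Or.inl h),
          h₂.pullField_eq_zero fun h => hx (Or.inr h), add_zero])
      (f₁.add f₂) (l₁.add l₂) (M := M₁ + M₂)
      (fun x => (norm_add_le _ _).trans (add_le_add (hM₁ x) (hM₂ x)))
      (ae_norm_pullField_add_le hΩ h₁ h₂ hφ₁.norm_le_one hφ₂.norm_le_one) (hu.mono_set hAΩ)
    have hmax : ENNReal.ofReal (max (2 + biG Ω γ₁ γ₂) 0) = ENNReal.ofReal (2 + biG Ω γ₁ γ₂) := by
      simp [ENNReal.ofReal, Real.toNNReal]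
    rw [hmax] at hmain
    refine le_trans (ENNReal.ofReal_le_ofReal (le_of_eq ?_)) hmain
    rw [setIntegral_mul_divergence_eq (h₁.image_subset hAΩ) hΩ.measurableSet _
        hφ₁.tsupport_subset,
      setIntegral_mul_divergence_eq (h₂.image_subset hAΩ) hΩ.measurableSet _
        hφ₂.tsupport_subset,
      h₁.integral_pushforward_mul_divergence hΩ, h₂.integral_pushforward_mul_divergence hΩ]
    have hint : ∀ {h : Eu m → ℝ} {M : ℝ}, LocallyIntegrable h → (∀ x, ‖h x‖ ≤ M) →
        IntegrableOn (fun x => u x * h x) Ω := fun hh hM =>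
      hu.mul_bdd hh.aestronglyMeasurable.restrict (Eventually.of_forall hM)
    have hset : ∫ x in A, u x * (pullDiv Ω γ₁ φ₁ x + pullDiv Ω γ₂ φ₂ x)
        = ∫ x in Ω, u x * (pullDiv Ω γ₁ φ₁ x + pullDiv Ω γ₂ φ₂ x) := by
      refine (setIntegral_eq_of_subset_of_forall_sdiff_eq_zero hΩ.measurableSet hAΩ
        fun x hx => ?_).symm
      rw [h₁.pullDiv_eq_zero fun h => hx.2 (hK₁ h),
        h₂.pullDiv_eq_zero fun h => hx.2 (hK₂ h), add_zero, mul_zero]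
    rw [hset]
    simp only [mul_add]
    rw [integral_add (hint l₁ hM₁) (hint l₂ hM₂)]
  unfold TV
  refine ENNReal.biSup_add_biSup_le' ⟨_, isTestField_zero _⟩ ⟨_, isTestField_zero _⟩ ?_
  intro φ₁ hφ₁ φ₂ hφ₂
  obtain ⟨χ₁, hχ₁, hp₁, he₁⟩ := exists_testField_nonneg (pushforward γ₁ u) hφ₁
  obtain ⟨χ₂, hχ₂, hp₂, he₂⟩ := exists_testField_nonneg (pushforward γ₂ u) hφ₂
  rw [he₁, he₂, ← ENNReal.ofReal_add hp₁ hp₂]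
  exact key χ₁ hχ₁ χ₂ hχ₂

end

/-! ### Existence of the gradient of a push-forward -/

/-- The variation of gν is ‖g‖ν, so both sides are continuous in f for the same L¹ norm, and it
suffices to check indicators. -/
lemma integral_withDensityᵥ {X : Type*} [MeasurableSpace X] {ν : Measure X} {g : X → Eu m}
    (hg : Integrable g ν) {f : X → ℝ} (hf : Integrable f (ν.withDensityᵥ g).variation) :
    ∫ᵛ x, f x ∂•(ν.withDensityᵥ g) = ∫ x, f x • g x ∂ν := by
  have hvar : (ν.withDensityᵥ g).variation = ν.withDensity fun x => (‖g x‖₊ : ℝ≥0∞) :=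
    Measure.variation_withDensityᵥ hg
  have hgm : AEMeasurable (fun x => ‖g x‖₊) ν := hg.aestronglyMeasurable.nnnorm.aemeasurable
  have hint : ∀ {h : X → ℝ}, Integrable h (ν.withDensityᵥ g).variation →
      Integrable (fun x => h x • g x) ν := by
    intro h hh
    rw [hvar, integrable_withDensity_iff_integrable_smul₀ hgm] at hh
    refine (integrable_norm_iff ?_).1 ?_
    · have h1 : AEStronglyMeasurable (fun x => ‖g x‖₊ • h x) ν := hh.aestronglyMeasurable
      -- Only ‖g‖h is known to be ν-a.e. measurable, so the product is factored through it and the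
      -- direction g/‖g‖.
      have h2 : (fun x => h x • g x)
          = fun x => (‖g x‖₊ • h x) • (‖g x‖⁻¹ • g x) := by
        ext1 x
        rcases eq_or_ne (g x) 0 with h0 | h0
        · simp [h0]
        · rw [smul_smul, NNReal.smul_def, coe_nnnorm, smul_eq_mul, mul_right_comm,
            mul_inv_cancel₀ (norm_ne_zero_iff.2 h0), one_mul]
      rw [h2]
      exact h1.smul ((hg.aestronglyMeasurable.norm.aemeasurable.inv.aestronglyMeasurable).smul
        hg.aestronglyMeasurable)
    · refine hh.norm.congr (Eventually.of_forall fun x => ?_)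
      simp [norm_smul, NNReal.smul_def, mul_comm]
  refine hf.induction (P := fun f => ∫ᵛ x, f x ∂•(ν.withDensityᵥ g) = ∫ x, f x • g x ∂ν)
    ?_ ?_ ?_ ?_
  · intro c s hs hc
    rw [VectorMeasure.integral_indicator_const _ hs]
    have : (fun x => s.indicator (fun _ => c) x • g x) = s.indicator (fun x => c • g x) := by
      ext1 x
      by_cases hx : x ∈ s <;> simp [hx]
    rw [this, integral_indicator hs, integral_smul, withDensityᵥ_apply hg hs]
    simp
  · intro f₁ f₂ _ i₁ i₂ e₁ e₂
    rw [VectorMeasure.integral_add i₁ i₂, e₁, e₂, ← integral_add (hint i₁) (hint i₂)]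
    simp only [Pi.add_apply, add_smul]
  · refine isClosed_eq VectorMeasure.continuous_integral ?_
    have hlip : LipschitzWith 1 (fun f : X →₁[(ν.withDensityᵥ g).variation] ℝ =>
        ∫ x, f x • g x ∂ν) := by
      refine LipschitzWith.of_dist_le_mul fun f₁ f₂ => ?_
      have i₁ := L1.integrable_coeFn f₁
      have i₂ := L1.integrable_coeFn f₂
      rw [dist_eq_norm, ← integral_sub (hint i₁) (hint i₂), NNReal.coe_one, one_mul,
        L1.dist_eq_integral_dist]
      refine (norm_integral_le_integral_norm _).trans (le_of_eq ?_)
      simp only [← sub_smul]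
      have hd : ∀ h : X → ℝ, ∫ x, h x ∂(ν.withDensityᵥ g).variation = ∫ x, ‖g x‖₊ • h x ∂ν :=
        fun h => by rw [hvar, integral_withDensity_eq_integral_smul₀ hgm]
      rw [hd]
      refine integral_congr_ae (Eventually.of_forall fun x => ?_)
      simp [norm_smul, NNReal.smul_def, mul_comm, Real.dist_eq]
    exact hlip.continuous
  · intro f₁ f₂ h12 _ e₁
    rw [← VectorMeasure.integral_congr_ae h12, e₁]
    rw [hvar] at h12
    refine integral_congr_ae ?_
    filter_upwards [(ae_withDensity_iff' hgm.coe_nnreal_ennreal).1 h12] with x hx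
    rcases eq_or_ne (g x) 0 with h0 | h0
    · simp [h0]
    · rw [hx (by simpa using h0)]

/-- The smooth vector fields with compact support in `Ω`. -/
def testFields (Ω : Set (Eu m)) : Submodule ℝ (Eu m → Eu m) where
  carrier := {η | ContDiff ℝ ∞ η ∧ HasCompactSupport η ∧ tsupport η ⊆ Ω}
  zero_mem' := ⟨contDiff_const, HasCompactSupport.zero, by
    have : tsupport (0 : Eu m → Eu m) = ∅ := tsupport_eq_empty_iff.2 rfl
    simp [this]⟩
  add_mem' {η χ} hη hχ := ⟨hη.1.add hχ.1, hη.2.1.add hχ.2.1,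
    (tsupport_add η χ).trans (union_subset hη.2.2 hχ.2.2)⟩
  smul_mem' c η hη := ⟨hη.1.const_smul c, hη.2.1.smul_left (f := fun _ => c),
    (closure_mono (Function.support_const_smul_subset c η)).trans hη.2.2⟩

lemma memLp_coe_of_hasCompactSupport {Ω : Set (Eu m)} (ν : Measure Ω) [IsFiniteMeasure ν]
    {η : Eu m → Eu m} (hη : Continuous η) (hc : HasCompactSupport η) :
    MemLp (fun x : Ω => η x) 2 ν := by
  obtain ⟨C, hC⟩ := hc.exists_bound_of_continuous hη
  exact MemLp.of_bound (hη.comp continuous_subtype_val).aestronglyMeasurable C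
    (Eventually.of_forall fun x => hC x)

/-- A function whose distributional gradient is dominated by a finite measure has a gradient
measure. -/
theorem exists_hasGradientMeasure {Ω : Set (Eu m)} {w : Eu m → ℝ} (hw : IntegrableOn w Ω)
    (ν : Measure Ω) [IsFiniteMeasure ν] (C : ℝ) (hC0 : 0 ≤ C)
    (hC : ∀ η ∈ testFields Ω, |∫ x in Ω, w x * divergence η x| ≤ C * ∫ x : Ω, ‖η x‖ ∂ν) :
    ∃ μ : VectorMeasure Ω (Eu m), HasGradientMeasure Ω w μ := by
  let T : testFields Ω →ₗ[ℝ] ℝ :=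
    { toFun := fun η => ∫ x in Ω, w x * divergence η x
      map_add' := fun η χ => by
        rw [← integral_add (integrable_mul_divergence hw η.2.1 η.2.2.1)
          (integrable_mul_divergence hw χ.2.1 χ.2.2.1)]
        refine integral_congr_ae (Eventually.of_forall fun x => ?_)
        have := divergence_add η.2.1 χ.2.1 x
        change w x * divergence (fun y => η.1 y + χ.1 y) x = _
        rw [this, mul_add]
      map_smul' := fun c η => by
        rw [RingHom.id_apply, smul_eq_mul, ← integral_const_mul]
        refine integral_congr_ae (Eventually.of_forall fun x => ?_)
        have := divergence_const_smul c η.2.1 x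
        change w x * divergence (fun y => c • η.1 y) x = _
        rw [this]
        ring }
  have hmem : ∀ η : testFields Ω, MemLp (fun x : Ω => η.1 x) 2 ν := fun η =>
    memLp_coe_of_hasCompactSupport ν η.2.1.continuous η.2.2.1
  let J : testFields Ω →ₗ[ℝ] Lp (Eu m) 2 ν :=
    { toFun := fun η => (hmem η).toLp
      map_add' := fun η χ => by
        rw [← MemLp.toLp_add]
        rfl
      map_smul' := fun c η => by
        rw [RingHom.id_apply, ← MemLp.toLp_const_smul]
        rfl }
  obtain ⟨D, hD0, hD⟩ : ∃ D : ℝ, 0 ≤ D ∧ ∀ η, |T η| ≤ D * ‖J η‖ := by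
    -- Since ν is finite, Cauchy–Schwarz upgrades the L¹(ν) bound to an L²(ν) bound, which makes
    -- Hilbert space duality available.
    refine ⟨C * (ν univ).toReal ^ (1 / 2 : ℝ), by positivity, fun η => ?_⟩
    refine (hC η.1 η.2).trans ?_
    rw [mul_assoc]
    refine mul_le_mul_of_nonneg_left ?_ hC0
    have h1 := eLpNorm_le_eLpNorm_mul_rpow_measure_univ (p := 1) (q := 2) (μ := ν)
      (by norm_num) (hmem η).1
    have h2 := ENNReal.toReal_mono (ENNReal.mul_ne_top (hmem η).2.ne
      (ENNReal.rpow_ne_top_of_nonneg (by norm_num) (measure_ne_top ν univ))) h1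
    rw [ENNReal.toReal_mul, ← ENNReal.toReal_rpow] at h2
    have h3 : ‖J η‖ = (eLpNorm (fun x : Ω => η.1 x) 2 ν).toReal :=
      Lp.norm_toLp _ (hmem η)
    have h4 : ∫ x : Ω, ‖η.1 x‖ ∂ν = (eLpNorm (fun x : Ω => η.1 x) 1 ν).toReal := by
      rw [eLpNorm_one_eq_lintegral_enorm, integral_norm_eq_lintegral_enorm (hmem η).1]
    rw [h3, h4, mul_comm]
    refine h2.trans (le_of_eq ?_)
    congr 2
    norm_num
  -- Fields that agree ν-a.e. have the same pairing, so `T` descends to the range of `J` in L²(ν).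
  -- Hahn–Banach and Riesz then represent it by some v ∈ L²(ν).
  have hker : LinearMap.ker J ≤ LinearMap.ker T := by
    intro η hη
    have h := hD η
    rw [LinearMap.mem_ker.1 hη, norm_zero, mul_zero] at h
    exact LinearMap.mem_ker.2 (abs_nonpos_iff.1 h)
  let S : LinearMap.range J →ₗ[ℝ] ℝ :=
    ((LinearMap.ker J).liftQ T hker).comp J.quotKerEquivRange.symm.toLinearMap
  have hS : ∀ η, S ⟨J η, LinearMap.mem_range_self J η⟩ = T η := fun η => by
    simp only [S, LinearMap.comp_apply, LinearEquiv.coe_coe]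
    rw [LinearMap.quotKerEquivRange_symm_apply_image J η (LinearMap.mem_range_self J η)]
    simp
  let S' : StrongDual ℝ (LinearMap.range J) := S.mkContinuous D (by
    rintro ⟨_, η, rfl⟩
    rw [hS]
    exact hD η)
  obtain ⟨G, hG, -⟩ := exists_extension_norm_eq (LinearMap.range J) S'
  let v : Lp (Eu m) 2 ν := (InnerProductSpace.toDual ℝ (Lp (Eu m) 2 ν)).symm G
  have hv : ∀ η : testFields Ω, ∫ x in Ω, w x * divergence η.1 x
      = ∫ x : Ω, inner ℝ (v x) (η.1 x) ∂ν := by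
    intro η
    have h1 : inner ℝ v (J η) = T η := by
      rw [InnerProductSpace.toDual_symm_apply]
      exact (hG ⟨J η, LinearMap.mem_range_self J η⟩).trans (hS η)
    rw [L2.inner_def] at h1
    refine h1.symm.trans (integral_congr_ae ?_)
    filter_upwards [(hmem η).coeFn_toLp] with x hx
    have : (J η) x = η.1 x := hx
    rw [this]
  have hvi : Integrable v ν := (Lp.memLp v).integrable (by norm_num)
  -- The density represents the pairing with the divergence, hence minus the gradient. Testing with
  -- the fields ψe, e constant, recovers the vector identity.
  refine ⟨-ν.withDensityᵥ v, fun ψ hψ hψc hψs => ?_⟩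
  have hψi : ∀ (ν' : Measure Ω) [IsFiniteMeasure ν'], Integrable (fun x : Ω => ψ x) ν' :=
    fun ν' _ => integrable_coe_of_hasCompactSupport ν' hψ.continuous hψc
  rw [VectorMeasure.integral_neg_vectorMeasure, neg_neg, integral_withDensityᵥ hvi (hψi _)]
  obtain ⟨B, hB⟩ := hψc.exists_bound_of_continuous hψ.continuous
  have hψv : Integrable (fun x : Ω => ψ x • v x) ν :=
    hvi.bdd_smul B (hψi ν).aestronglyMeasurable (Eventually.of_forall fun x => hB x)
  refine ext_inner_left ℝ fun e => ?_
  rw [← integral_inner (integrable_smul_gradient hw hψ hψc), ← integral_inner hψv]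
  have hη : (fun x => ψ x • e) ∈ testFields Ω := by
    refine ⟨hψ.smul contDiff_const, hψc.smul_right, ?_⟩
    exact (tsupport_smul_subset_left ψ (fun _ => e)).trans hψs
  have h := hv ⟨_, hη⟩
  simp only [divergence_smul_const hψ] at h
  simp only [inner_smul_right, inner_gradient_right]
  rw [h]
  refine integral_congr_ae (Eventually.of_forall fun x => ?_)
  simp only [inner_smul_right]
  rw [real_inner_comm]

namespace IsLipTransform

variable {Ω U : Set (Eu m)} {γ : PartialEquiv (Eu m) (Eu m)} (hγ : IsLipTransform Ω U γ)

include hγ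

/-- A Lipschitz transformation as a homeomorphism of `Ω`. -/
def homeomorph : Ω ≃ₜ Ω where
  toFun x := ⟨γ x, hγ.mapsTo x.2⟩
  invFun x := ⟨γ.symm x, hγ.symm.mapsTo x.2⟩
  left_inv x := Subtype.ext (hγ.left_inv x.2)
  right_inv x := Subtype.ext (hγ.right_inv x.2)
  continuous_toFun := (continuousOn_iff_continuous_domRestrict.1 hγ.continuousOn).subtype_mk _
  continuous_invFun :=
    (continuousOn_iff_continuous_domRestrict.1 hγ.symm.continuousOn).subtype_mk _

lemma homeomorph_symm_apply (x : Ω) : (hγ.homeomorph.symm x : Eu m) = γ.symm x := rfl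

/-- The set γ⁻¹(supp φ) is compact inside Ω, so the extension by zero has no jump at the boundary.
The result is a continuous majorant, up to a constant, of the merely measurable pulled-back field.
-/
lemma continuous_indicator_norm (hΩ : IsOpen Ω) {φ : Eu m → Eu m} (hφ : Continuous φ)
    (hc : HasCompactSupport φ) (hs : tsupport φ ⊆ Ω) :
    Continuous (Ω.indicator fun x => ‖φ (γ x)‖) := by
  refine continuous_iff_continuousAt.2 fun x => ?_
  by_cases hx : x ∈ Ω
  · have h1 : ContinuousAt (fun x => ‖φ (γ x)‖) x :=
      (hφ.continuousAt.comp (hγ.continuousOn.continuousAt (hΩ.mem_nhds hx))).norm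
    refine h1.congr ?_
    filter_upwards [hΩ.mem_nhds hx] with y hy
    rw [indicator_of_mem hy]
  · have hK := hγ.isCompact_preimage hc hs
    have hxK : x ∉ γ.symm '' tsupport φ := fun h =>
      hx (hγ.symm.image_subset hs h)
    refine (continuousAt_const (y := (0 : ℝ))).congr ?_
    filter_upwards [hK.isClosed.isOpen_compl.mem_nhds hxK] with y hy
    by_cases hyΩ : y ∈ Ω
    · rw [indicator_of_mem hyΩ,
        image_eq_zero_of_notMem_tsupport (hγ.notMem_of_notMem_preimage hyΩ hy), norm_zero]
    · rw [indicator_of_notMem hyΩ]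

/-- The pulled-back field is mollified and paired with Du, its norm being dominated by the
mollification of a continuous majorant. -/
lemma exists_abs_integral_pushforward_le (hΩ : IsOpen Ω) :
    ∃ C : ℝ, 0 ≤ C ∧ ∀ (u : Eu m → ℝ) (μ : VectorMeasure Ω (Eu m)), IntegrableOn u Ω →
      HasGradientMeasure Ω u μ → ∀ φ ∈ testFields Ω,
      |∫ x in Ω, pushforward γ u x * divergence φ x| ≤ C * ∫ x : Ω, ‖φ (γ x)‖ ∂μ.variation := by
  obtain ⟨C, hC0, hC⟩ := hγ.exists_pullField_le hΩ
  refine ⟨C, hC0, fun u μ hu hμ φ hφ => ?_⟩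
  obtain ⟨hφs, hφc, hφΩ⟩ := hφ
  obtain ⟨M, hM⟩ := hγ.exists_pullDiv_le hΩ hφs hφc
  have hl := hγ.locallyIntegrable_pullDiv hΩ hφs hφc
  have hf := hγ.locallyIntegrable_pullField hΩ hφs hφc
  have hw := hγ.hasWeakDiv_pull hΩ hφs hφc hφΩ
  have hK := hγ.isCompact_preimage hφc hφΩ
  have hKΩ : γ.symm '' tsupport φ ⊆ Ω := hγ.symm.image_subset hφΩ
  set g : Eu m → ℝ := fun x => C * Ω.indicator (fun x => ‖φ (γ x)‖) x with hg
  have hgc : Continuous g := continuous_const.mul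
    (hγ.continuous_indicator_norm hΩ hφs.continuous hφc hφΩ)
  obtain ⟨B, hB⟩ := hφc.exists_bound_of_continuous hφs.continuous
  have hB0 : 0 ≤ B := (norm_nonneg _).trans (hB 0)
  have hgB : ∀ x, ‖g x‖ ≤ C * B := by
    intro x
    rw [hg, norm_mul, Real.norm_of_nonneg hC0]
    refine mul_le_mul_of_nonneg_left ?_ hC0
    by_cases hx : x ∈ Ω
    · simpa [hx] using hB (γ x)
    · simpa [hx] using hB0
  rw [hγ.integral_pushforward_mul_divergence hΩ]
  have hlim := (tendsto_integral_mul_mollify hu hl hM).abs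
  -- Continuity of the majorant gives convergence at every point. Convergence almost everywhere
  -- would not do, as |Du| may be singular to Lebesgue measure.
  have hlim' : Tendsto (fun k => ∫ x : Ω, mollify k g x ∂μ.variation) atTop
      (𝓝 (∫ x : Ω, g x ∂μ.variation)) := by
    refine tendsto_integral_of_dominated_convergence (fun _ => C * B) (fun k => ?_)
      (integrable_const _) (fun k => ?_) ?_
    · exact ((contDiff_mollify k hgc.locallyIntegrable).continuous.comp
        continuous_subtype_val).aestronglyMeasurable
    · exact Eventually.of_forall fun x =>
        norm_mollify_le_const k (Eventually.of_forall hgB) _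
    · exact Eventually.of_forall fun x => tendsto_mollify hgc _
  have hfin : ∫ x : Ω, g x ∂μ.variation = C * ∫ x : Ω, ‖φ (γ x)‖ ∂μ.variation := by
    rw [← integral_const_mul]
    refine integral_congr_ae (Eventually.of_forall fun x => ?_)
    simp [hg]
  rw [← hfin]
  refine le_of_tendsto_of_tendsto hlim hlim' ?_
  filter_upwards [eventually_tsupport_mollify_subset (F := Eu m) hK hΩ hKΩ] with k hk
  have h0 : ∀ x ∉ γ.symm '' tsupport φ, pullField Ω γ φ x = 0 := fun x hx =>
    hγ.pullField_eq_zero hx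
  simp only [← hw.divergence_mollify hf]
  refine (hμ.abs_integral_mul_divergence_le hu (contDiff_mollify k hf)
    (hasCompactSupport_mollify hK h0) (hk _ h0)).trans ?_
  refine integral_mono ?_ ?_ fun x =>
    norm_mollify_le k hgc.locallyIntegrable (Eventually.of_forall (hC φ)) x
  · exact (integrable_coe_of_hasCompactSupport _ (contDiff_mollify k hf).continuous
      (hasCompactSupport_mollify hK h0)).norm
  · exact integrable_of_bounded _ ((contDiff_mollify k hgc.locallyIntegrable).continuous.comp
      continuous_subtype_val) fun x => norm_mollify_le_const k (Eventually.of_forall hgB) _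

/-- The push-forward of a function of bounded variation is of bounded variation. -/
theorem exists_hasGradientMeasure_pushforward (hΩ : IsOpen Ω) {u : Eu m → ℝ}
    {μ : VectorMeasure Ω (Eu m)} (hu : IntegrableOn u Ω) (hμ : HasGradientMeasure Ω u μ) :
    ∃ D : VectorMeasure Ω (Eu m), HasGradientMeasure Ω (pushforward γ u) D := by
  obtain ⟨C, hC0, hC⟩ := hγ.exists_abs_integral_pushforward_le hΩ
  have hcont := hγ.homeomorph.continuous
  refine exists_hasGradientMeasure (hγ.integrableOn_pushforward hΩ hu)
    (μ.variation.map hγ.homeomorph) C hC0 fun η hη => ?_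
  have h : ∫ x : Ω, ‖η x‖ ∂(μ.variation.map hγ.homeomorph) = ∫ x : Ω, ‖η (γ x)‖ ∂μ.variation :=
    integral_map hcont.aemeasurable
      (hη.1.continuous.comp continuous_subtype_val).norm.aestronglyMeasurable
  rw [h]
  exact hC u μ hu hμ η hη

end IsLipTransform

/-! ### Comparison of the gradient measures -/

lemma measure_le_of_isOpen {X : Type*} [TopologicalSpace X] [MeasurableSpace X]
    (κ₁ κ₂ : Measure X) [κ₂.OuterRegular] (h : ∀ O, IsOpen O → κ₁ O ≤ κ₂ O) : κ₁ ≤ κ₂ := by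
  refine Measure.le_intro fun S _ _ => ?_
  rw [S.measure_eq_iInf_isOpen κ₂]
  exact le_iInf₂ fun O hO => le_iInf fun hO' => (measure_mono hO).trans (h O hO')

lemma essSup_nonneg {X : Type*} [MeasurableSpace X] (ν : Measure X) {f : X → ℝ}
    (hf : ∀ x, 0 ≤ f x) : 0 ≤ essSup f ν := by
  rw [essSup, limsup_eq]
  rcases (ae ν).eq_or_neBot with h | h
  -- On a null domain every real is an a.e. bound, and the infimum of all of ℝ is 0 by convention.
  · simp [h]
  · exact Real.sInf_nonneg fun a ha => by
      obtain ⟨x, hx⟩ := Eventually.exists (f := ae ν) (p := fun x => f x ≤ a) ha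
      exact (hf x).trans hx

lemma biG_le_biT (Ω : Set (Eu m)) (γ₁ γ₂ : PartialEquiv (Eu m) (Eu m)) :
    biG Ω γ₁ γ₂ ≤ biT Ω γ₁ γ₂ := by
  have h : 0 ≤ biJ Ω γ₁ γ₂ := essSup_nonneg _ fun x => abs_nonneg _
  unfold biT
  nlinarith [sq_nonneg (distId Ω γ₁), sq_nonneg (distId Ω γ₂)]

namespace IsLipTransform

variable {Ω U : Set (Eu m)} {γ : PartialEquiv (Eu m) (Eu m)} (hγ : IsLipTransform Ω U γ)

include hγ

/-- The pull-back of the total variation measure `|D|` along a Lipschitz transformation. -/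
def pullVar (D : VectorMeasure Ω (Eu m)) : Measure Ω := D.variation.map hγ.homeomorph.symm

lemma pullVar_apply (D : VectorMeasure Ω (Eu m)) {A : Set (Eu m)}
    (hA : MeasurableSet ((↑) ⁻¹' A : Set Ω)) :
    hγ.pullVar D ((↑) ⁻¹' A) = varOn D (γ '' (A ∩ Ω)) := by
  rw [pullVar, Measure.map_apply hγ.homeomorph.symm.continuous.measurable hA, varOn]
  congr 1
  ext y
  rw [hγ.image_eq inter_subset_right]
  simp only [mem_preimage, mem_inter_iff]
  rw [hγ.homeomorph_symm_apply]
  exact ⟨fun h => ⟨y.2, h, hγ.symm.mapsTo y.2⟩, fun h => h.2.1⟩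

lemma pullVar_eq_TV (hΩ : IsOpen Ω) {w : Eu m → ℝ} (hw : IntegrableOn w Ω)
    {D : VectorMeasure Ω (Eu m)} (hD : HasGradientMeasure Ω w D) {O : Set Ω} (hO : IsOpen O) :
    hγ.pullVar D O = TV (γ '' ((↑) '' O)) w := by
  have hOE : IsOpen ((↑) '' O : Set (Eu m)) := hΩ.isOpenMap_subtype_val _ hO
  have hOΩ : ((↑) '' O : Set (Eu m)) ⊆ Ω := Subtype.coe_image_subset Ω O
  rw [← hD.varOn_eq_TV hw hΩ (hγ.isOpen_image hΩ hOE hOΩ) (hγ.image_subset hOΩ)]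
  have h := hγ.pullVar_apply D (A := (↑) '' O)
    (by rw [preimage_image_eq _ Subtype.val_injective]; exact hO.measurableSet)
  rwa [preimage_image_eq _ Subtype.val_injective, inter_eq_left.2 hOΩ] at h

/-- Off U both γ and γ⁻¹ are the identity, so the push-forward coincides with u on the open set O,
and so do the local total variations. -/
lemma pullVar_eq_of_disjoint (hΩ : IsOpen Ω) {u : Eu m → ℝ} (hu : IntegrableOn u Ω)
    {μ D : VectorMeasure Ω (Eu m)} (hμ : HasGradientMeasure Ω u μ)
    (hD : HasGradientMeasure Ω (pushforward γ u) D) {O : Set Ω} (hO : IsOpen O)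
    (hOU : ∀ x ∈ O, (x : Eu m) ∉ U) : hγ.pullVar D O = μ.variation O := by
  have hOE : IsOpen ((↑) '' O : Set (Eu m)) := hΩ.isOpenMap_subtype_val _ hO
  have hOΩ : ((↑) '' O : Set (Eu m)) ⊆ Ω := Subtype.coe_image_subset Ω O
  have hfix : γ '' ((↑) '' O) = ((↑) '' O : Set (Eu m)) := by
    have : EqOn γ id ((↑) '' O) := by
      rintro _ ⟨x, hx, rfl⟩
      exact hγ.eq_self x ⟨x.2, hOU x hx⟩
    rw [this.image_eq, image_id]
  rw [hγ.pullVar_eq_TV hΩ (hγ.integrableOn_pushforward hΩ hu) hD hO, hfix]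
  have hTV : TV ((↑) '' O) (pushforward γ u) = TV ((↑) '' O) u := by
    refine TV_congr_ae ?_
    filter_upwards [ae_restrict_mem hOE.measurableSet] with x hx
    obtain ⟨y, hy, rfl⟩ := hx
    simp only [pushforward, Function.comp_apply]
    rw [hγ.symm.eq_self y ⟨y.2, hOU y hy⟩]
  rw [hTV, ← hμ.varOn_eq_TV hu hΩ hOE hOΩ, varOn, preimage_image_eq _ Subtype.val_injective]

instance isFiniteMeasure_pullVar (D : VectorMeasure Ω (Eu m)) :
    IsFiniteMeasure (hγ.pullVar D) := by
  unfold pullVar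
  infer_instance

lemma pullVar_restrict_le (hΩ : IsOpen Ω) {u : Eu m → ℝ} (hu : IntegrableOn u Ω)
    {μ D : VectorMeasure Ω (Eu m)} (hμ : HasGradientMeasure Ω u μ)
    (hD : HasGradientMeasure Ω (pushforward γ u) D) {W : Set Ω} (hW : IsOpen W)
    (hWU : ∀ x ∈ W, (x : Eu m) ∉ U) {S : Set Ω} (hS : MeasurableSet S) :
    hγ.pullVar D (S ∩ W) ≤ μ.variation (S ∩ W) := by
  have h : (hγ.pullVar D).restrict W ≤ μ.variation.restrict W := by
    refine measure_le_of_isOpen _ _ fun O hO => ?_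
    rw [Measure.restrict_apply hO.measurableSet, Measure.restrict_apply hO.measurableSet]
    exact (hγ.pullVar_eq_of_disjoint hΩ hu hμ hD (hO.inter hW) fun x hx => hWU x hx.2).le
  have := h S
  rwa [Measure.restrict_apply hS, Measure.restrict_apply hS] at this

end IsLipTransform

section

variable {Ω U : Set (Eu m)} {γ₁ γ₂ : PartialEquiv (Eu m) (Eu m)}

/-- On open sets this is `TV_image_add_le` rewritten through gradient measures; outer regularity of
|Du| extends it to all sets. -/
lemma pullVar_add_le (hΩ : IsOpen Ω) (h₁ : IsLipTransform Ω U γ₁) (h₂ : IsLipTransform Ω U γ₂)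
    {u : Eu m → ℝ} (hu : IntegrableOn u Ω) {μ D₁ D₂ : VectorMeasure Ω (Eu m)}
    (hμ : HasGradientMeasure Ω u μ) (hD₁ : HasGradientMeasure Ω (pushforward γ₁ u) D₁)
    (hD₂ : HasGradientMeasure Ω (pushforward γ₂ u) D₂) (S : Set Ω) :
    h₁.pullVar D₁ S + h₂.pullVar D₂ S ≤ ENNReal.ofReal (2 + biG Ω γ₁ γ₂) * μ.variation S := by
  have h : h₁.pullVar D₁ + h₂.pullVar D₂ ≤ Real.toNNReal (2 + biG Ω γ₁ γ₂) • μ.variation := by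
    refine measure_le_of_isOpen _ _ fun O hO => ?_
    have hOE : IsOpen ((↑) '' O : Set (Eu m)) := hΩ.isOpenMap_subtype_val _ hO
    have hOΩ : ((↑) '' O : Set (Eu m)) ⊆ Ω := Subtype.coe_image_subset Ω O
    have hk := TV_image_add_le hΩ h₁ h₂ hu hOE hOΩ
    rw [← h₁.pullVar_eq_TV hΩ (h₁.integrableOn_pushforward hΩ hu) hD₁ hO,
      ← h₂.pullVar_eq_TV hΩ (h₂.integrableOn_pushforward hΩ hu) hD₂ hO,
      ← hμ.varOn_eq_TV hu hΩ hOE hOΩ, varOn, preimage_image_eq _ Subtype.val_injective] at hk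
    exact hk
  exact h S

/-- Needed to read the bound with `ENNReal.ofReal` as an inequality of real numbers. It comes from
testing with one unit vector at one point, hence the conditions on m and Ω. -/
lemma two_add_biG_nonneg (hm : 0 < m) (hΩ : IsOpen Ω) (hne : Ω.Nonempty)
    (h₁ : IsLipTransform Ω U γ₁) (h₂ : IsLipTransform Ω U γ₂) : 0 ≤ 2 + biG Ω γ₁ γ₂ := by
  have hv : volume.restrict Ω ≠ 0 := by
    rw [Ne, Measure.restrict_eq_zero]
    exact (hΩ.measure_pos volume hne).ne'
  have : NeBot (ae (volume.restrict Ω)) := ae_neBot.2 hv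
  obtain ⟨x, hx⟩ := (ae_norm_lipJac_add_le hΩ h₁ h₂).exists
  have := hx (EuclideanSpace.single ⟨0, hm⟩ 1)
  have h1 : ‖(EuclideanSpace.single ⟨0, hm⟩ 1 : Eu m)‖ = 1 := by simp
  rw [h1, mul_one] at this
  exact le_trans (by positivity) this

/-- The localised comparison of `|Dγ₁#u|`, `|Dγ₂#u|` and `|Du|`. -/
lemma pullVar_real_add_sub_le (hm : 0 < m) (hΩ : IsOpen Ω) (h₁ : IsLipTransform Ω U γ₁)
    (h₂ : IsLipTransform Ω U γ₂)
    {u : Eu m → ℝ} (hu : IntegrableOn u Ω) {μ D₁ D₂ : VectorMeasure Ω (Eu m)}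
    (hμ : HasGradientMeasure Ω u μ) (hD₁ : HasGradientMeasure Ω (pushforward γ₁ u) D₁)
    (hD₂ : HasGradientMeasure Ω (pushforward γ₂ u) D₂) {S : Set Ω} (hS : MeasurableSet S) :
    (h₁.pullVar D₁).real S + (h₂.pullVar D₂).real S - 2 * μ.variation.real S
      ≤ biT Ω γ₁ γ₂ * μ.variation.real (S ∩ (↑) ⁻¹' closure U) := by
  rcases Ω.eq_empty_or_nonempty with he | hne
  · have hS0 : S = ∅ := eq_empty_of_forall_notMem fun x => by
      have := x.2
      simp [he] at this
    simp [hS0]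
  have hb := two_add_biG_nonneg hm hΩ hne h₁ h₂
  -- On `F` the joint bound applies. Its complement is open and misses U, so there each pulled-back
  -- measure is at most |Du|; the closure is taken for the sake of this openness.
  set F : Set Ω := (↑) ⁻¹' closure U with hF
  have hFc : IsClosed F := isClosed_closure.preimage continuous_subtype_val
  have hWU : ∀ x ∈ Fᶜ, (x : Eu m) ∉ U := fun x hx h => hx (subset_closure h)
  have a₁ := h₁.pullVar_restrict_le hΩ hu hμ hD₁ hFc.isOpen_compl hWU hS
  have a₂ := h₂.pullVar_restrict_le hΩ hu hμ hD₂ hFc.isOpen_compl hWU hS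
  have a := pullVar_add_le hΩ h₁ h₂ hu hμ hD₁ hD₂ (S ∩ F)
  have b₁ : (h₁.pullVar D₁).real (S ∩ Fᶜ) ≤ μ.variation.real (S ∩ Fᶜ) :=
    ENNReal.toReal_mono (measure_ne_top _ _) a₁
  have b₂ : (h₂.pullVar D₂).real (S ∩ Fᶜ) ≤ μ.variation.real (S ∩ Fᶜ) :=
    ENNReal.toReal_mono (measure_ne_top _ _) a₂
  have b : (h₁.pullVar D₁).real (S ∩ F) + (h₂.pullVar D₂).real (S ∩ F)
      ≤ (2 + biG Ω γ₁ γ₂) * μ.variation.real (S ∩ F) := by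
    have h := ENNReal.toReal_mono (ENNReal.mul_ne_top ENNReal.ofReal_ne_top
      (measure_ne_top _ _)) a
    rwa [ENNReal.toReal_add (measure_ne_top _ _) (measure_ne_top _ _), ENNReal.toReal_mul,
      ENNReal.toReal_ofReal hb] at h
  have s : ∀ (ν : Measure Ω) [IsFiniteMeasure ν], ν.real S = ν.real (S ∩ F) + ν.real (S ∩ Fᶜ) :=
    fun ν _ => (measureReal_inter_add_sdiff hFc.measurableSet).symm
  rw [s (h₁.pullVar D₁), s (h₂.pullVar D₂), s μ.variation]
  have hT := mul_le_mul_of_nonneg_right (biG_le_biT Ω γ₁ γ₂)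
    (measureReal_nonneg (μ := μ.variation) (s := S ∩ F))
  linarith

end

/-! ### Double-Lipschitz comparability -/

lemma coe_ofReal_mul {α : ℝ} (hα : 0 < α) {X : ℝ≥0∞} (hX : X ≠ ⊤) :
    ((ENNReal.ofReal α * X : ℝ≥0∞) : EReal) = ((α * X.toReal : ℝ) : EReal) := by
  rw [← EReal.coe_ennreal_toReal (ENNReal.mul_ne_top ENNReal.ofReal_ne_top hX),
    ENNReal.toReal_mul, ENNReal.toReal_ofReal hα.le]

lemma TV_eq_pullVar {Ω U : Set (Eu m)} {γ : PartialEquiv (Eu m) (Eu m)} (hΩ : IsOpen Ω)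
    (hγ : IsLipTransform Ω U γ) {w : Eu m → ℝ} (hw : IntegrableOn w Ω)
    {D : VectorMeasure Ω (Eu m)} (hD : HasGradientMeasure Ω w D) :
    TV Ω w = hγ.pullVar D univ := by
  rw [hγ.pullVar_eq_TV hΩ hw hD isOpen_univ, image_univ, Subtype.range_coe, hγ.image_univ]

theorem isDoubleLipschitzComparable_TV (hm : 0 < m) {Ω : Set (Eu m)} (hΩ : IsOpen Ω) {α : ℝ}
    (hα : 0 < α) : IsDoubleLipschitzComparable Ω (fun u => ENNReal.ofReal α * TV Ω u) := by
  refine ⟨α, hα.le, fun u μ hu hμ U _ _ γ₁ γ₂ h₁ h₂ _ => ?_⟩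
  obtain ⟨D₁, hD₁⟩ := h₁.exists_hasGradientMeasure_pushforward hΩ hu hμ
  obtain ⟨D₂, hD₂⟩ := h₂.exists_hasGradientMeasure_pushforward hΩ hu hμ
  have e : TV Ω u = μ.variation univ := by
    rw [← hμ.varOn_eq_TV hu hΩ hΩ Subset.rfl, varOn, Subtype.coe_preimage_self]
  have key := pullVar_real_add_sub_le hm hΩ h₁ h₂ hu hμ hD₁ hD₂ MeasurableSet.univ
  rw [univ_inter] at key
  simp only
  rw [TV_eq_pullVar hΩ h₁ (h₁.integrableOn_pushforward hΩ hu) hD₁,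
    TV_eq_pullVar hΩ h₂ (h₂.integrableOn_pushforward hΩ hu) hD₂, e,
    coe_ofReal_mul hα (measure_ne_top _ _), coe_ofReal_mul hα (measure_ne_top _ _),
    coe_ofReal_mul hα (measure_ne_top _ _), varOn, ← EReal.coe_ennreal_toReal (measure_ne_top _ _)]
  have hk := mul_le_mul_of_nonneg_left key hα.le
  simp only [Measure.real] at hk
  rw [show (2 : EReal) = ((2 : ℝ) : EReal) from rfl]
  simp only [← EReal.coe_mul, ← EReal.coe_add, ← EReal.coe_sub, EReal.coe_le_coe_iff]
  linarith

/-- A continuous injective image of a Borel set is Borel (Lusin–Souslin). The parametrisation is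
injective because the component along z determines the rest: a difference of base points that is
parallel and orthogonal to z vanishes. -/
lemma IsLipschitzGraph.measurableSet {Γ : Set (Eu m)} (h : IsLipschitzGraph Γ) :
    MeasurableSet Γ := by
  obtain ⟨z, hz, V, f, hV, ⟨L, hL⟩, rfl⟩ := h
  borelize (ℝ ∙ z)ᗮ
  refine hV.measurableSet.image_of_continuousOn_injOn ?_ ?_
  · exact continuous_subtype_val.continuousOn.add (hL.continuousOn.smul continuousOn_const)
  · intro v _ w _ hvw
    have h1 : ((v - w : (ℝ ∙ z)ᗮ) : Eu m) = (f w - f v) • z := by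
      have h2 : (v : Eu m) + f v • z = w + f w • z := hvw
      rw [Submodule.coe_sub, sub_smul, sub_eq_sub_iff_add_eq_add, h2]
      abel
    have h3 : inner ℝ z ((v - w : (ℝ ∙ z)ᗮ) : Eu m) = 0 :=
      Submodule.mem_orthogonal_singleton_iff_inner_right.1 (v - w).2
    rw [h1, inner_smul_right, real_inner_self_eq_norm_sq, hz, one_pow, mul_one] at h3
    rw [h3, zero_smul] at h1
    exact sub_eq_zero.1 (Subtype.ext h1)

/-- The total mass is split along Γ. On Ω \ Γ the localised comparison applies, while the terms on Γ
are literally those multiplied by R^s = α. -/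
theorem isSeparablyDoubleLipschitzComparable_TV (hm : 0 < m) {Ω : Set (Eu m)} (hΩ : IsOpen Ω)
    {α : ℝ} (hα : 0 < α) :
    IsSeparablyDoubleLipschitzComparable Ω (fun u => ENNReal.ofReal α * TV Ω u) := by
  refine ⟨α, α, hα.le, hα.le, fun u μ hu hμ U _ _ γ₁ γ₂ h₁ h₂ _ Γ hΓ => ?_⟩
  obtain ⟨D₁, hD₁⟩ := h₁.exists_hasGradientMeasure_pushforward hΩ hu hμ
  obtain ⟨D₂, hD₂⟩ := h₂.exists_hasGradientMeasure_pushforward hΩ hu hμ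
  refine ⟨D₁, D₂, hD₁, hD₂, ?_⟩
  have e : TV Ω u = μ.variation univ := by
    rw [← hμ.varOn_eq_TV hu hΩ hΩ Subset.rfl, varOn, Subtype.coe_preimage_self]
  have hG : MeasurableSet ((↑) ⁻¹' Γ : Set Ω) := hΓ.measurableSet.preimage measurable_subtype_coe
  have key := pullVar_real_add_sub_le hm hΩ h₁ h₂ hu hμ hD₁ hD₂ hG.compl
  rw [inter_comm, ← sdiff_eq, ← preimage_sdiff] at key
  have s : ∀ (ν : Measure Ω) [IsFiniteMeasure ν],
      ν.real univ = ν.real ((↑) ⁻¹' Γ) + ν.real ((↑) ⁻¹' Γ)ᶜ := fun ν _ =>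
    (measureReal_add_measureReal_compl hG).symm
  have s₁ := s (h₁.pullVar D₁)
  have s₂ := s (h₂.pullVar D₂)
  have s₀ := s μ.variation
  simp only
  rw [TV_eq_pullVar hΩ h₁ (h₁.integrableOn_pushforward hΩ hu) hD₁,
    TV_eq_pullVar hΩ h₂ (h₂.integrableOn_pushforward hΩ hu) hD₂, e,
    coe_ofReal_mul hα (measure_ne_top _ _), coe_ofReal_mul hα (measure_ne_top _ _),
    coe_ofReal_mul hα (measure_ne_top _ _), ← h₁.pullVar_apply D₁ hG, ← h₂.pullVar_apply D₂ hG,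
    varOn, varOn, ← EReal.coe_ennreal_toReal (measure_ne_top μ.variation _),
    ← EReal.coe_ennreal_toReal (measure_ne_top μ.variation _),
    ← EReal.coe_ennreal_toReal (measure_ne_top (h₁.pullVar D₁) _),
    ← EReal.coe_ennreal_toReal (measure_ne_top (h₂.pullVar D₂) _)]
  simp only [Measure.real] at key s₁ s₂ s₀
  rw [s₁, s₂, s₀]
  have hk := mul_le_mul_of_nonneg_left key hα.le
  rw [show (2 : EReal) = ((2 : ℝ) : EReal) from rfl]
  simp only [← EReal.coe_mul, ← EReal.coe_add, ← EReal.coe_sub, EReal.coe_le_coe_iff]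
  linarith

/-! ### Truncation does not increase the total variation -/

/-- The truncation of `y` to the interval `[-M, M]`. -/
def clamp (M y : ℝ) : ℝ := max (-M) (min M y)

lemma lipschitzWith_clamp (M : ℝ) : LipschitzWith 1 (clamp M) :=
  (LipschitzWith.id.const_min M).const_max (-M)

lemma abs_clamp_le {M : ℝ} (hM : 0 ≤ M) (y : ℝ) : |clamp M y| ≤ M :=
  abs_le.2 ⟨le_max_left _ _, max_le (by linarith) (min_le_left _ _)⟩

lemma clamp_zero {M : ℝ} (hM : 0 ≤ M) : clamp M 0 = 0 := by
  simp [clamp, hM]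

lemma abs_clamp_le_abs {M : ℝ} (hM : 0 ≤ M) (y : ℝ) : |clamp M y| ≤ |y| := by
  have h := (lipschitzWith_clamp M).norm_sub_le y 0
  simpa [clamp_zero hM] using h

lemma clamp_eq_self {M y : ℝ} (hy : |y| ≤ M) : clamp M y = y := by
  obtain ⟨h1, h2⟩ := abs_le.1 hy
  rw [clamp, min_eq_right h2, max_eq_right h1]

lemma abs_sub_clamp_le {M t : ℝ} (ht : |t| ≤ M) (y : ℝ) : |t - clamp M y| ≤ |t - y| := by
  have h := (lipschitzWith_clamp M).norm_sub_le t y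
  simpa [clamp_eq_self ht] using h

lemma abs_sub_clamp_lt {M t y : ℝ} (ht : |t| ≤ M) (hy : M < |y|) : |t - clamp M y| < |t - y| := by
  obtain ⟨h1, h2⟩ := abs_le.1 ht
  have hM : 0 ≤ M := (abs_nonneg t).trans ht
  rcases lt_abs.1 hy with h | h
  · rw [clamp, min_eq_left h.le, max_eq_right (by linarith), abs_of_nonpos (by linarith),
      abs_of_nonpos (by linarith)]
    linarith
  · rw [clamp, min_eq_right (by linarith), max_eq_left (by linarith), abs_of_nonneg (by linarith),
      abs_of_nonneg (by linarith)]
    linarith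

/-- Increments of c ∘ w are bounded by those of w, so no chain rule for the nonsmooth c is needed.
Where c ∘ w is not differentiable, its `fderiv` is 0 by convention. -/
lemma norm_fderiv_comp_le_of_lipschitzWith_one {c : ℝ → ℝ} (hc : LipschitzWith 1 c)
    {w : Eu m → ℝ} {x : Eu m} (hw : DifferentiableAt ℝ w x) :
    ‖fderiv ℝ (c ∘ w) x‖ ≤ ‖fderiv ℝ w x‖ := by
  by_cases hd : DifferentiableAt ℝ (c ∘ w) x
  · refine le_of_forall_pos_le_add fun ε hε => ?_
    refine hd.hasFDerivAt.le_of_lip' (by positivity) ?_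
    filter_upwards [hw.hasFDerivAt.isLittleO.def hε] with y hy
    have h1 : ‖(c ∘ w) y - (c ∘ w) x‖ ≤ ‖w y - w x‖ := by
      simpa using hc.norm_sub_le (w y) (w x)
    have h2 := norm_le_norm_add_norm_sub' (w y - w x) (fderiv ℝ w x (y - x))
    have h3 := (fderiv ℝ w x).le_opNorm (y - x)
    linarith
  · rw [fderiv_zero_of_not_differentiableAt hd, norm_zero]
    exact norm_nonneg _

lemma exists_lipschitzWith_mollify (k : ℕ) {u : Eu m → ℝ} (hu : Integrable u) :
    ∃ L, LipschitzWith L (mollify k u) := by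
  obtain ⟨K, hK⟩ := exists_lipschitzWith (contDiff_kern (m := m) k) (hasCompactSupport_kern k)
  refine ⟨Real.toNNReal (K * ∫ t, ‖u t‖), LipschitzWith.of_dist_le' fun x y => ?_⟩
  rw [dist_eq_norm, mollify_apply, mollify_apply, ← integral_sub
    (integrable_kern_smul k hu.locallyIntegrable x) (integrable_kern_smul k hu.locallyIntegrable y)]
  refine (norm_integral_le_of_norm_le (g := fun t => (K * dist x y) * ‖u t‖)
    (hu.norm.const_mul _) (Eventually.of_forall fun t => ?_)).trans_eq ?_
  · rw [← sub_smul, norm_smul]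
    refine mul_le_mul_of_nonneg_right ?_ (norm_nonneg _)
    simpa [dist_eq_norm] using hK.norm_sub_le (x - t) (y - t)
  · rw [integral_const_mul]
    ring

/-- Mollification is symmetric in the pairing of gradients with vector fields. -/
lemma integral_fderiv_mollify (k : ℕ) {u : Eu m → ℝ} (hu : Integrable u) {η : Eu m → Eu m}
    (hη : Integrable η) :
    ∫ x, fderiv ℝ (mollify k u) x (η x) = -∫ x, u x * divergence (mollify k η) x := by
  obtain ⟨K, hK⟩ := exists_lipschitzWith (contDiff_kern (m := m) k) (hasCompactSupport_kern k)
  have hcont : Continuous (fderiv ℝ (kern m k)) := (contDiff_kern k).continuous_fderiv (by simp)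
  have hint : Integrable (fun p : Eu m × Eu m => fderiv ℝ (kern m k) (p.1 - p.2) (η p.1) * u p.2)
      (volume.prod volume) := by
    refine ((hη.norm.mul_prod hu.norm).const_mul (K : ℝ)).mono' ?_
      (Eventually.of_forall fun p => ?_)
    · refine AEStronglyMeasurable.mul ?_ hu.aestronglyMeasurable.comp_snd
      exact (isBoundedBilinearMap_apply (𝕜 := ℝ) (E := Eu m)
        (F := ℝ)).continuous.comp_aestronglyMeasurable
        ((hcont.comp (continuous_fst.sub continuous_snd)).aestronglyMeasurable.prodMk
          hη.aestronglyMeasurable.comp_fst)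
    · rw [norm_mul, ← mul_assoc]
      refine mul_le_mul_of_nonneg_right (((fderiv ℝ (kern m k) _).le_opNorm _).trans ?_)
        (norm_nonneg _)
      exact mul_le_mul_of_nonneg_right (norm_fderiv_le_of_lipschitz ℝ hK) (norm_nonneg _)
  simp only [fderiv_mollify k hu.locallyIntegrable, smul_eq_mul,
    divergence_mollify k hη.locallyIntegrable]
  rw [integral_integral_swap hint, ← integral_neg]
  congr 1 with t
  rw [integral_mul_const, mul_comm, ← mul_neg, ← integral_neg]
  congr 2 with x
  -- The kernel is even, so its derivative is odd; this produces the sign of the integration by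
  -- parts.
  rw [← neg_sub t x, fderiv_kern_neg, neg_apply]

/-- The integral over K is attained by the field -∇w/‖∇w‖ on K, where w is the mollified function.
Moving the mollification onto this field makes it a smooth test field, supported in Ω by the
hypothesis on k. -/
lemma integral_norm_fderiv_mollify_le {Ω K : Set (Eu m)} {k : ℕ} {u : Eu m → ℝ} (hΩ : IsOpen Ω)
    (hu : IntegrableOn u Ω) (hK : IsCompact K)
    (hk : ∀ f : Eu m → Eu m, (∀ x ∉ K, f x = 0) → tsupport (mollify k f) ⊆ Ω) :
    ENNReal.ofReal (∫ x in K, ‖fderiv ℝ (mollify k (Ω.indicator u)) x‖) ≤ TV Ω u := by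
  have hu0 : Integrable (Ω.indicator u) := (integrable_indicator_iff hΩ.measurableSet).2 hu
  set w := mollify k (Ω.indicator u) with hw
  have hcd : ContDiff ℝ ∞ w := contDiff_mollify k hu0.locallyIntegrable
  have hgc : Continuous (gradient w) :=
    (InnerProductSpace.toDual ℝ (Eu m)).symm.continuous.comp (hcd.continuous_fderiv (by simp))
  set η : Eu m → Eu m := K.indicator fun x => -(‖gradient w x‖⁻¹ • gradient w x) with hη
  have hη1 : ∀ x, ‖η x‖ ≤ 1 := fun x => by
    by_cases hx : x ∈ K
    · rw [hη, indicator_of_mem hx, norm_neg, norm_smul, norm_inv, norm_norm]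
      exact inv_mul_le_one
    · simp [hη, indicator_of_notMem hx]
  have hη0 : ∀ x ∉ K, η x = 0 := fun x hx => indicator_of_notMem hx _
  have hηi : Integrable η := by
    rw [hη, integrable_indicator_iff hK.measurableSet]
    refine Measure.integrableOn_of_bounded (M := 1) hK.measure_lt_top.ne ?_ ?_
    · exact (hgc.measurable.norm.inv.smul hgc.measurable).neg.aestronglyMeasurable
    · refine Eventually.of_forall fun x => ?_
      rw [norm_neg, norm_smul, norm_inv, norm_norm]
      exact inv_mul_le_one
  have e : ∫ x in K, ‖fderiv ℝ w x‖ = ∫ x in Ω, u x * divergence (mollify k η) x := by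
    have h1 := integral_fderiv_mollify k hu0 hηi
    have h2 : ∀ x, fderiv ℝ w x (η x) = -K.indicator (fun x => ‖fderiv ℝ w x‖) x := fun x => by
      by_cases hx : x ∈ K
      · rw [hη, indicator_of_mem hx, indicator_of_mem hx, map_neg, map_smul,
          ← inner_gradient_left, real_inner_self_eq_norm_sq,
          smul_eq_mul]
        have : ‖gradient w x‖ = ‖fderiv ℝ w x‖ :=
          (InnerProductSpace.toDual ℝ (Eu m)).symm.norm_map _
        rw [this]
        by_cases h0 : ‖fderiv ℝ w x‖ = 0
        · simp [h0]
        · field_simp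
      · simp [hη, indicator_of_notMem hx]
    simp only [← hw, h2, integral_neg, neg_inj] at h1
    rw [integral_indicator hK.measurableSet] at h1
    rw [h1, ← integral_indicator hΩ.measurableSet]
    congr 1 with x
    by_cases hx : x ∈ Ω <;> simp [hx]
  rw [e]
  exact le_TV u ⟨contDiff_mollify k hηi.locallyIntegrable, hasCompactSupport_mollify hK hη0,
    hk η hη0, norm_mollify_le_const k (Eventually.of_forall hη1)⟩

/-- For a fixed test field, u is mollified before truncation. The truncated mollification is
Lipschitz, integration by parts bounds its pairing by the gradient integral over supp φ, and the
mollification parameter tends to its limit. -/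
theorem TV_clamp_le {Ω : Set (Eu m)} (hΩ : IsOpen Ω) {u : Eu m → ℝ} (hu : IntegrableOn u Ω)
    {M : ℝ} (hM : 0 ≤ M) : TV Ω (fun x => clamp M (u x)) ≤ TV Ω u := by
  refine iSup₂_le fun φ hφ => ?_
  have hu0 : Integrable (Ω.indicator u) := (integrable_indicator_iff hΩ.measurableSet).2 hu
  have hdc := continuous_divergence hφ.contDiff
  have hdi : Integrable (divergence φ) :=
    hdc.integrable_of_hasCompactSupport (hasCompactSupport_divergence hφ.hasCompactSupport)
  have e : ∫ x in Ω, clamp M (u x) * divergence φ x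
      = ∫ x, clamp M (Ω.indicator u x) * divergence φ x := by
    rw [← integral_indicator hΩ.measurableSet]
    congr 1 with x
    by_cases hx : x ∈ Ω <;> simp [hx, clamp_zero hM]
  have hlim : Tendsto (fun k => ∫ x, clamp M (mollify k (Ω.indicator u) x) * divergence φ x) atTop
      (𝓝 (∫ x, clamp M (Ω.indicator u x) * divergence φ x)) := by
    refine tendsto_integral_of_dominated_convergence (fun x => M * ‖divergence φ x‖) (fun k => ?_)
      (hdi.norm.const_mul M) (fun k => Eventually.of_forall fun x => ?_) ?_
    · exact (((lipschitzWith_clamp M).continuous.comp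
        (contDiff_mollify k hu0.locallyIntegrable).continuous).mul hdc).aestronglyMeasurable
    · rw [norm_mul]
      exact mul_le_mul_of_nonneg_right (abs_clamp_le hM _) (norm_nonneg _)
    · filter_upwards [ae_tendsto_mollify hu0.locallyIntegrable] with x hx
      exact (((lipschitzWith_clamp M).continuous.tendsto _).comp hx).mul_const _
  rw [e]
  refine le_of_tendsto ((ENNReal.continuous_ofReal.tendsto _).comp hlim) ?_
  have hK : IsCompact (tsupport φ) := hφ.hasCompactSupport
  filter_upwards [eventually_tsupport_mollify_subset (F := Eu m) hK hΩ hφ.tsupport_subset] with k hk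
  refine le_trans (ENNReal.ofReal_le_ofReal ?_) (integral_norm_fderiv_mollify_le hΩ hu hK hk)
  obtain ⟨L, hL⟩ := exists_lipschitzWith_mollify k hu0
  have hcd : ContDiff ℝ ∞ (mollify k (Ω.indicator u)) := contDiff_mollify k hu0.locallyIntegrable
  have hp := integral_lipschitz_mul_divergence ((lipschitzWith_clamp M).comp hL) hφ.contDiff
    hφ.hasCompactSupport
  simp only [Function.comp_apply] at hp ⊢
  rw [hp, ← integral_neg, ← integral_indicator hK.measurableSet]
  have hcf : Continuous (fderiv ℝ (mollify k (Ω.indicator u))) := hcd.continuous_fderiv (by simp)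
  refine (Real.le_norm_self _).trans (norm_integral_le_of_norm_le
    ((integrable_indicator_iff hK.measurableSet).2
      (hcf.norm.continuousOn.integrableOn_compact hK)) (Eventually.of_forall fun x => ?_))
  by_cases hx : x ∈ tsupport φ
  · rw [indicator_of_mem hx, norm_neg]
    refine (ContinuousLinearMap.le_opNorm _ _).trans ?_
    refine (mul_le_of_le_one_right (norm_nonneg _) (hφ.norm_le_one x)).trans ?_
    exact norm_fderiv_comp_le_of_lipschitzWith_one (lipschitzWith_clamp M)
      (hcd.differentiable (by simp) x)
  · rw [indicator_of_notMem hx, image_eq_zero_of_notMem_tsupport hx]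
    simp

/-! ### The maximum principle -/

lemma IsPIncreasing.le_of_abs_le {p : ℝ} {φ : ℝ → ℝ≥0∞} (h : IsPIncreasing p φ) {x y : ℝ}
    (hxy : |x| ≤ |y|) : φ x ≤ φ y := by
  obtain ⟨C, hC, hφ⟩ := h
  have h1 : C * (|x| - |y|) * |x| ^ (p - 1) ≤ 0 :=
    mul_nonpos_of_nonpos_of_nonneg (mul_nonpos_of_nonneg_of_nonpos hC.le (by linarith))
      (by positivity)
  have h2 : ((C * (|x| - |y|) * |x| ^ (p - 1) : ℝ) : EReal) ≤ 0 := by exact_mod_cast h1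
  have h3 := (hφ x y).trans (add_le_add_right h2 _)
  rw [add_zero] at h3
  exact_mod_cast h3

lemma IsPIncreasing.lt_of_abs_lt {p : ℝ} {φ : ℝ → ℝ≥0∞} (h : IsPIncreasing p φ) {x y : ℝ}
    (hxy : |x| < |y|) (hy : φ x ≠ ⊤) : φ x < φ y := by
  -- The growth condition degenerates at x = 0 when p > 1, so it is applied at an intermediate z >
  -- 0.
  obtain ⟨z, hz1, hz2⟩ := exists_between hxy
  have hz0 : 0 < z := (abs_nonneg x).trans_lt hz1
  have hxz : φ x ≤ φ z := h.le_of_abs_le (by rw [abs_of_pos hz0]; exact hz1.le)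
  obtain ⟨C, hC, hφ⟩ := h
  by_contra hcon
  rw [not_lt] at hcon
  have h1 : C * (|z| - |y|) * |z| ^ (p - 1) < 0 := by
    rw [abs_of_pos hz0]
    exact mul_neg_of_neg_of_pos (mul_neg_of_pos_of_neg hC (by linarith)) (by positivity)
  have hz := hφ z y
  have hyt : φ y ≠ ⊤ := ne_top_of_le_ne_top hy hcon
  have hzt : φ z ≠ ⊤ := by
    intro ht
    rw [ht, ← EReal.coe_ennreal_toReal hyt, ← EReal.coe_add, EReal.coe_ennreal_top,
      top_le_iff] at hz
    exact EReal.coe_ne_top _ hz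
  rw [← EReal.coe_ennreal_toReal hyt, ← EReal.coe_ennreal_toReal hzt, ← EReal.coe_add,
    EReal.coe_le_coe_iff] at hz
  have := ENNReal.toReal_mono hzt (hcon.trans hxz)
  linarith

lemma IsPIncreasing.exists_le_rpow {p : ℝ} {φ : ℝ → ℝ≥0∞} (h : IsPIncreasing p φ) (h0 : φ 0 = 0)
    (hp : 1 ≤ p) {M : ℝ} : ∃ B : ℝ, 0 ≤ B ∧ ∀ x, |x| ≤ M → φ x ≤ ENNReal.ofReal (B * |x|) := by
  obtain ⟨C, hC, hφ⟩ := h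
  refine ⟨C * |M| ^ (p - 1), by positivity, fun x hx => ?_⟩
  have h1 := hφ x 0
  rw [h0, EReal.coe_ennreal_zero, zero_add, abs_zero, sub_zero] at h1
  have h2 : C * |x| * |x| ^ (p - 1) ≤ C * |M| ^ (p - 1) * |x| := by
    rw [mul_right_comm]
    refine mul_le_mul_of_nonneg_right (mul_le_mul_of_nonneg_left ?_ hC.le) (abs_nonneg _)
    exact Real.rpow_le_rpow (abs_nonneg _) (hx.trans (le_abs_self _)) (by linarith)
  have h3 : (φ x : EReal) ≤ ((C * |M| ^ (p - 1) * |x| : ℝ) : EReal) :=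
    h1.trans (EReal.coe_le_coe_iff.2 h2)
  rw [← EReal.coe_ennreal_le_coe_ennreal_iff, EReal.coe_ennreal_ofReal, max_eq_left (by positivity)]
  exact h3

theorem eLpNorm_top_le_of_isSolution {Ω : Set (Eu m)} (hΩ : IsOpen Ω) {a : ℝ≥0∞} {p : ℝ}
    {φ : ℝ → ℝ≥0∞} (hp : 1 ≤ p) (hlsc : LowerSemicontinuous φ)
    (h0 : φ 0 = 0) (hφ : IsPIncreasing p φ) {f u : Eu m → ℝ} (hf : IntegrableOn f Ω)
    (hu : IsSolution Ω φ (fun u => a * TV Ω u) f u) :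
    eLpNorm u ⊤ (volume.restrict Ω) ≤ eLpNorm f ⊤ (volume.restrict Ω) := by
  rcases eq_or_ne (eLpNorm f ⊤ (volume.restrict Ω)) ⊤ with ht | ht
  · rw [ht]
    exact le_top
  obtain ⟨hui, hmin⟩ := hu
  set M : ℝ := (eLpNorm f ⊤ (volume.restrict Ω)).toReal with hMdef
  have hM : 0 ≤ M := ENNReal.toReal_nonneg
  have hfM : ∀ᵐ x ∂volume.restrict Ω, |f x| ≤ M := by
    filter_upwards [ae_le_eLpNormEssSup (f := f) (μ := volume.restrict Ω)] with x hx
    rw [← eLpNorm_exponent_top] at hx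
    have h := ENNReal.toReal_mono ht hx
    rwa [toReal_enorm, Real.norm_eq_abs] at h
  have hvi : IntegrableOn (fun x => clamp M (u x)) Ω :=
    Integrable.mono hui
      ((lipschitzWith_clamp M).continuous.comp_aestronglyMeasurable hui.aestronglyMeasurable)
      (Eventually.of_forall fun x => abs_clamp_le_abs hM _)
  -- The zero function has finite energy, because φ grows at most linearly on [-M, M] and f ∈ L¹.
  -- Finiteness permits both the cancellation of the `TV` term and the strict comparison of φ.
  have hfin : (∫⁻ x in Ω, φ (f x - u x)) + a * TV Ω u < ⊤ := by
    refine (hmin (fun _ => 0) integrableOn_zero).trans_lt ?_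
    have hTV0 : TV Ω (fun _ : Eu m => (0 : ℝ)) = 0 := by simp [TV]
    simp only [hTV0, mul_zero, add_zero, sub_zero]
    obtain ⟨B, hB, hle⟩ := hφ.exists_le_rpow h0 hp (M := M)
    refine (lintegral_mono_ae (hfM.mono fun x hx => hle _ hx)).trans_lt ?_
    exact (hf.abs.const_mul B).lintegral_lt_top
  have hmeas : ∀ g : Eu m → ℝ, IntegrableOn g Ω →
      AEMeasurable (fun x => φ (f x - g x)) (volume.restrict Ω) := fun g hg =>
    hlsc.measurable.comp_aemeasurable (hf.aemeasurable.sub hg.aemeasurable)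
  have hle : ∀ᵐ x ∂volume.restrict Ω, φ (f x - clamp M (u x)) ≤ φ (f x - u x) :=
    hfM.mono fun x hx => hφ.le_of_abs_le (abs_sub_clamp_le hx _)
  have hTVle := TV_clamp_le hΩ hui hM
  have h1 := hmin _ hvi
  have hTVt : a * TV Ω u ≠ ⊤ := (le_add_self.trans_lt hfin).ne
  have h2 : (∫⁻ x in Ω, φ (f x - u x)) ≤ ∫⁻ x in Ω, φ (f x - clamp M (u x)) := by
    refine ENNReal.le_of_add_le_add_right hTVt (h1.trans ?_)
    exact add_le_add_right (mul_le_mul_right hTVle a) _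
  have hut : (∫⁻ x in Ω, φ (f x - u x)) ≠ ⊤ := (le_self_add.trans_lt hfin).ne
  -- Truncation lowers the fidelity integrand pointwise without lowering its integral, so the
  -- integrands agree a.e.; strict monotonicity then excludes |u| > M.
  have heq := ae_eq_of_ae_le_of_lintegral_le hle
    (ne_top_of_le_ne_top hut (lintegral_mono_ae hle)) (hmeas u hui) h2
  have hae : ∀ᵐ x ∂volume.restrict Ω, ‖u x‖ₑ ≤ eLpNorm f ⊤ (volume.restrict Ω) := by
    filter_upwards [heq, hfM, ae_lt_top' (hmeas u hui) hut] with x hx hfx hux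
    have hxM : |u x| ≤ M := by
      by_contra hcon
      exact (hφ.lt_of_abs_lt (abs_sub_clamp_lt hfx (not_le.1 hcon)) (hx ▸ hux.ne)).ne hx
    rw [← ENNReal.ofReal_toReal ht, ← hMdef, ← ofReal_norm]
    exact ENNReal.ofReal_le_ofReal hxM
  rw [eLpNorm_exponent_top]
  exact essSup_le_of_ae_le _ hae

end TVReg

end

theorem proposition4p1 {m : ℕ} (hm : 2 ≤ m) {Ω : Set (TVReg.Eu m)} (hΩ : IsOpen Ω)
    {α : ℝ} (hα : 0 < α) :
    TVReg.IsAdmissible Ω (fun u => ENNReal.ofReal α * TVReg.TV Ω u) ∧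
    TVReg.IsDoubleLipschitzComparable Ω (fun u => ENNReal.ofReal α * TVReg.TV Ω u) ∧
    TVReg.IsSeparablyDoubleLipschitzComparable Ω (fun u => ENNReal.ofReal α * TVReg.TV Ω u) ∧
    ∀ (p : ℝ) (φ : ℝ → ℝ≥0∞), 1 ≤ p → ConvexOn ℝ≥0 Set.univ φ → LowerSemicontinuous φ →
      φ 0 = 0 → TVReg.IsPIncreasing p φ →
      ∀ f u : TVReg.Eu m → ℝ, IntegrableOn f Ω →
        TVReg.IsSolution Ω φ (fun u => ENNReal.ofReal α * TVReg.TV Ω u) f u →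
        eLpNorm u ⊤ (volume.restrict Ω) ≤ eLpNorm f ⊤ (volume.restrict Ω) := by
  exact ⟨TVReg.isAdmissible_TV hα, TVReg.isDoubleLipschitzComparable_TV (by omega) hΩ hα,
    TVReg.isSeparablyDoubleLipschitzComparable_TV (by omega) hΩ hα,
    fun _ _ hp _ hlsc h0 hφ _ _ hf hu =>
      TVReg.eLpNorm_top_le_of_isSolution hΩ hp hlsc h0 hφ hf hu⟩
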